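/- Consider first-order formulas built with the connectives $\lnot,\land,\lor,\Rightarrow,\Leftrightarrow$ and the quantifiers $\exists x$, $\forall x$ from the following atoms: order constraints $x\bowtie y$, difference constraints $x-y\bowtie c$, and predicate atoms $P(x)$, where $x,y$ are variables, $c\in\mathbb{Z}$ is an integer constant, $\bowtie\ \in\{<,\le,=,\ge,>\}$, and $P$ is an uninterpreted unary predicate symbol (countably many such symbols are available). Variables and quantifiers range over $\mathbb{R}$, the arithmetic symbols have their usual meaning, and a formula is satisfiable if it is true for some assignment of subsets of $\mathbb{R}$ to the predicate symbols and of real numbers to the free variables. Call a set of formulas a decidable fragment if there is an algorithm that, on every formula of the set, terminates and answers correctly whether the formula is satisfiable. Then satisfiability is undecidable even when only a single predicate symbol is allowed: for every predicate symbol $P$, the set of formulas in which no predicate symbol other than $P$ occurs is not a decidable fragment. In particular, the set of all formulas is not a decidable fragment. -/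

import Mathlib

namespace RealDiffLogic

/-- The comparison symbols `<`, `≤`, `=`, `≥`, `>`. -/
inductive Cmp : Type
  | lt
  | le
  | eq
  | ge
  | gt

/-- Interpretation of a comparison symbol on the reals. -/
def Cmp.Holds : Cmp → ℝ → ℝ → Prop
  | .lt, a, b => a < b
  | .le, a, b => a ≤ b
  | .eq, a, b => a = b
  | .ge, a, b => a ≥ b
  | .gt, a, b => a > b

/-- Formulas of quantified difference logic with unary uninterpreted predicates.
First-order variables and predicate symbols are named by natural numbers. -/
inductive Formula : Type
  /-- the order constraint `x ⋈ y` between variables -/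
  | order (r : Cmp) (x y : ℕ)
  /-- the difference constraint `x - y ⋈ c` with `c` an integer constant -/
  | diff (r : Cmp) (x y : ℕ) (c : ℤ)
  /-- the atom `P(x)`, where `P` is the `p`-th predicate symbol -/
  | pred (p x : ℕ)
  | not (φ : Formula)
  | and (φ ψ : Formula)
  | or (φ ψ : Formula)
  | imp (φ ψ : Formula)
  | iff (φ ψ : Formula)
  | ex (x : ℕ) (φ : Formula)
  | all (x : ℕ) (φ : Formula)

namespace Formula

/-- Truth of a formula over the domain `ℝ`, where `I p` is the subset of `ℝ` assigned to the
`p`-th predicate symbol and `v x` is the real number assigned to the variable `x`. -/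
def Holds (I : ℕ → Set ℝ) : Formula → (ℕ → ℝ) → Prop
  | order r x y, v => r.Holds (v x) (v y)
  | diff r x y c, v => r.Holds (v x - v y) (c : ℝ)
  | pred p x, v => v x ∈ I p
  | not φ, v => ¬ Holds I φ v
  | and φ ψ, v => Holds I φ v ∧ Holds I ψ v
  | or φ ψ, v => Holds I φ v ∨ Holds I ψ v
  | imp φ ψ, v => Holds I φ v → Holds I ψ v
  | iff φ ψ, v => (Holds I φ v ↔ Holds I ψ v)
  | ex x φ, v => ∃ a : ℝ, Holds I φ (Function.update v x a)
  | all x φ, v => ∀ a : ℝ, Holds I φ (Function.update v x a)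

/-- Satisfiability over `ℝ`: some interpretation of the predicate symbols and of the free
variables makes the formula true. -/
def Satisfiable (φ : Formula) : Prop :=
  ∃ (I : ℕ → Set ℝ) (v : ℕ → ℝ), φ.Holds I v

/-- The set of predicate symbols that occur in a formula. -/
def preds : Formula → Finset ℕ
  | order _ _ _ => ∅
  | diff _ _ _ _ => ∅
  | pred p _ => {p}
  | not φ => φ.preds
  | and φ ψ => φ.preds ∪ ψ.preds
  | or φ ψ => φ.preds ∪ ψ.preds
  | imp φ ψ => φ.preds ∪ ψ.preds
  | iff φ ψ => φ.preds ∪ ψ.preds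
  | ex _ φ => φ.preds
  | all _ φ => φ.preds

end Formula

/-! Gödel numbering of formulas: an explicit bijection with `ℕ`, in which the outermost
constructor is the residue modulo `10` and the arguments are paired in the quotient. -/

/-- The index of a comparison symbol. -/
def Cmp.code : Cmp → ℕ
  | .lt => 0
  | .le => 1
  | .eq => 2
  | .ge => 3
  | .gt => 4

/-- The comparison symbol with a given index. -/
def Cmp.ofCode : ℕ → Cmp
  | 0 => .lt
  | 1 => .le
  | 2 => .eq
  | 3 => .ge
  | _ => .gt

theorem Cmp.code_lt (r : Cmp) : r.code < 5 := by
  cases r <;> decide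

theorem Cmp.ofCode_code (r : Cmp) : Cmp.ofCode r.code = r := by
  cases r <;> rfl

theorem Cmp.code_ofCode : ∀ n < 5, (Cmp.ofCode n).code = n := by
  decide

namespace Formula

/-- The Gödel number of a formula. -/
def encode : Formula → ℕ
  | order r x y => 10 * (5 * Nat.pair x y + r.code)
  | diff r x y c =>
      10 * (5 * Nat.pair (Nat.pair x y) (Encodable.encode c) + r.code) + 1
  | pred p x => 10 * Nat.pair p x + 2
  | not φ => 10 * φ.encode + 3
  | and φ ψ => 10 * Nat.pair φ.encode ψ.encode + 4
  | or φ ψ => 10 * Nat.pair φ.encode ψ.encode + 5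
  | imp φ ψ => 10 * Nat.pair φ.encode ψ.encode + 6
  | iff φ ψ => 10 * Nat.pair φ.encode ψ.encode + 7
  | ex x φ => 10 * Nat.pair x φ.encode + 8
  | all x φ => 10 * Nat.pair x φ.encode + 9

theorem encode_injective : Function.Injective encode := by
  intro φ
  induction φ with
  | order r x y =>
    intro ψ h
    cases ψ with
    | order r' x' y' =>
      have h1 := r.code_lt
      have h2 := r'.code_lt
      simp only [encode] at h
      have h3 : Nat.pair x y = Nat.pair x' y' := by omega
      have h4 : r.code = r'.code := by omega
      have h5 := congrArg Cmp.ofCode h4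
      rw [Cmp.ofCode_code, Cmp.ofCode_code] at h5
      rw [Nat.pair_eq_pair] at h3
      rw [h5, h3.1, h3.2]
    | _ => simp only [encode] at h; omega
  | diff r x y c =>
    intro ψ h
    cases ψ with
    | diff r' x' y' c' =>
      have h1 := r.code_lt
      have h2 := r'.code_lt
      simp only [encode] at h
      have h3 : Nat.pair (Nat.pair x y) (Encodable.encode c)
          = Nat.pair (Nat.pair x' y') (Encodable.encode c') := by omega
      have h4 : r.code = r'.code := by omega
      have h5 := congrArg Cmp.ofCode h4
      rw [Cmp.ofCode_code, Cmp.ofCode_code] at h5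
      rw [Nat.pair_eq_pair, Nat.pair_eq_pair] at h3
      rw [h5, h3.1.1, h3.1.2, Encodable.encode_injective h3.2]
    | _ => simp only [encode] at h; omega
  | pred p x =>
    intro ψ h
    cases ψ with
    | pred p' x' =>
      simp only [encode] at h
      have h3 : Nat.pair p x = Nat.pair p' x' := by omega
      rw [Nat.pair_eq_pair] at h3
      rw [h3.1, h3.2]
    | _ => simp only [encode] at h; omega
  | not φ ih =>
    intro ψ h
    cases ψ with
    | not φ' =>
      simp only [encode] at h
      rw [ih (a₂ := φ') (by omega)]
    | _ => simp only [encode] at h; omega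
  | and φ ψ ih1 ih2 =>
    intro χ h
    cases χ with
    | and φ' ψ' =>
      simp only [encode] at h
      have h3 : Nat.pair φ.encode ψ.encode = Nat.pair φ'.encode ψ'.encode := by omega
      rw [Nat.pair_eq_pair] at h3
      rw [ih1 h3.1, ih2 h3.2]
    | _ => simp only [encode] at h; omega
  | or φ ψ ih1 ih2 =>
    intro χ h
    cases χ with
    | or φ' ψ' =>
      simp only [encode] at h
      have h3 : Nat.pair φ.encode ψ.encode = Nat.pair φ'.encode ψ'.encode := by omega
      rw [Nat.pair_eq_pair] at h3
      rw [ih1 h3.1, ih2 h3.2]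
    | _ => simp only [encode] at h; omega
  | imp φ ψ ih1 ih2 =>
    intro χ h
    cases χ with
    | imp φ' ψ' =>
      simp only [encode] at h
      have h3 : Nat.pair φ.encode ψ.encode = Nat.pair φ'.encode ψ'.encode := by omega
      rw [Nat.pair_eq_pair] at h3
      rw [ih1 h3.1, ih2 h3.2]
    | _ => simp only [encode] at h; omega
  | iff φ ψ ih1 ih2 =>
    intro χ h
    cases χ with
    | iff φ' ψ' =>
      simp only [encode] at h
      have h3 : Nat.pair φ.encode ψ.encode = Nat.pair φ'.encode ψ'.encode := by omega
      rw [Nat.pair_eq_pair] at h3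
      rw [ih1 h3.1, ih2 h3.2]
    | _ => simp only [encode] at h; omega
  | ex x φ ih =>
    intro χ h
    cases χ with
    | ex x' φ' =>
      simp only [encode] at h
      have h3 : Nat.pair x φ.encode = Nat.pair x' φ'.encode := by omega
      rw [Nat.pair_eq_pair] at h3
      rw [h3.1, ih h3.2]
    | _ => simp only [encode] at h; omega
  | all x φ ih =>
    intro χ h
    cases χ with
    | all x' φ' =>
      simp only [encode] at h
      have h3 : Nat.pair x φ.encode = Nat.pair x' φ'.encode := by omega
      rw [Nat.pair_eq_pair] at h3
      rw [h3.1, ih h3.2]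
    | _ => simp only [encode] at h; omega

theorem encode_surjective : Function.Surjective encode := by
  intro n
  induction n using Nat.strong_induction_on with
  | _ n ih =>
    have hl := Nat.unpair_left_le (n / 10)
    have hr := Nat.unpair_right_le (n / 10)
    have hp := Nat.pair_unpair (n / 10)
    have hc : n % 10 = 0 ∨ n % 10 = 1 ∨ n % 10 = 2 ∨ n % 10 = 3 ∨ n % 10 = 4 ∨ n % 10 = 5 ∨
        n % 10 = 6 ∨ n % 10 = 7 ∨ n % 10 = 8 ∨ n % 10 = 9 := by omega
    have hm := Cmp.code_ofCode (n / 10 % 5) (by omega)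
    rcases hc with h | h | h | h | h | h | h | h | h | h
    · refine ⟨order (Cmp.ofCode (n / 10 % 5)) (n / 10 / 5).unpair.1 (n / 10 / 5).unpair.2, ?_⟩
      simp only [encode, hm, Nat.pair_unpair]
      omega
    · refine ⟨diff (Cmp.ofCode (n / 10 % 5)) (n / 10 / 5).unpair.1.unpair.1
        (n / 10 / 5).unpair.1.unpair.2 (Denumerable.ofNat ℤ (n / 10 / 5).unpair.2), ?_⟩
      simp only [encode, hm, Nat.pair_unpair, Denumerable.encode_ofNat]
      omega
    · refine ⟨pred (n / 10).unpair.1 (n / 10).unpair.2, ?_⟩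
      simp only [encode, Nat.pair_unpair]
      omega
    · obtain ⟨φ, hφ⟩ := ih (n / 10) (by omega)
      refine ⟨not φ, ?_⟩
      simp only [encode, hφ]
      omega
    all_goals
      obtain ⟨ψ, hψ⟩ := ih (n / 10).unpair.2 (by omega)
    case inr.inr.inr.inr.inr.inr.inr.inr.inl =>
      refine ⟨ex (n / 10).unpair.1 ψ, ?_⟩
      simp only [encode, hψ, hp]
      omega
    case inr.inr.inr.inr.inr.inr.inr.inr.inr =>
      refine ⟨all (n / 10).unpair.1 ψ, ?_⟩
      simp only [encode, hψ, hp]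
      omega
    all_goals
      obtain ⟨φ, hφ⟩ := ih (n / 10).unpair.1 (by omega)
    · refine ⟨and φ ψ, ?_⟩
      simp only [encode, hφ, hψ, hp]
      omega
    · refine ⟨or φ ψ, ?_⟩
      simp only [encode, hφ, hψ, hp]
      omega
    · refine ⟨imp φ ψ, ?_⟩
      simp only [encode, hφ, hψ, hp]
      omega
    · refine ⟨iff φ ψ, ?_⟩
      simp only [encode, hφ, hψ, hp]
      omega

/-- Formulas are numbered by `encode`. Mathlib's computability theory on the type of formulas
(through `Primcodable.ofDenumerable`) is therefore computability on these Gödel numbers. -/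
noncomputable instance : Denumerable Formula :=
  Denumerable.mk' (Equiv.ofBijective encode ⟨encode_injective, encode_surjective⟩)

theorem encode_eq (φ : Formula) : Encodable.encode φ = φ.encode := rfl

/-- A fragment is decidable if some algorithm (a partial recursive function) terminates on every
formula of the fragment and answers correctly whether the formula is satisfiable. -/
def DecidableFragment (F : Set Formula) : Prop :=
  ∃ f : Formula →. Bool, Partrec f ∧
    ∀ φ ∈ F, ∃ b ∈ f φ, (b = true ↔ φ.Satisfiable)

/-- The fragment of all formulas in which no predicate symbol other than the `p`-th one occurs. -/
def singlePredicate (p : ℕ) : Set Formula :=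
  {φ | φ.preds ⊆ {p}}

end Formula

end RealDiffLogic

/-! Non-halting reduces to satisfiability: for a while program `p` there are formulas in one
predicate symbol, computable from the input `m`, that are satisfiable exactly when `p` runs forever
on `m`.

Since ℝ is dense, an interval of length 1 has room for infinitely many columns. Copies of these
columns, shifted by multiples of `period`, form the rows of a grid. Rows are instants of time and
columns are natural numbers: a register with value `b` is a mark in column `b`, incrementing is
passage to the next grid point, and one execution step relates points at the constant distance
`period`.

A single set `P` suffices because the gaps between rows store the data. A grid point is an `x` with
`x` and `x + 1` in `P`; a datum of index `i` at `x` is the membership of `x + 3 + 2 * i`. In the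
intended model no two of the offsets 1, 3, 5, … are adjacent, so data never create spurious grid
points.

The input enters through one integer constant. Markers run down the diagonal, and the computation
starts at distance `period * m` below the first row, where the marker sits in column `m`.

The rules force marks to be present and forbid only the final state `[]`. Hence every model contains
the true history, which never ends (`iterate_step_ne_nil_of_satisfiable`); conversely the trace of
an endless run is a model (`Fits.satisfiable_history`). Control states are lists of pending
programs, of which only finitely many occur (`exists_finset_successors_subset`). Undecidability then
comes from the halting problem, through `exists_exec_iff_dom`. -/

namespace RealDiffLogic

/-! ### While programs compute all partial recursive functions. -/

/-- While programs acting on registers that are named by natural numbers. -/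
inductive Prog : Type
  /-- set register `r` to `0` -/
  | zero (r : ℕ)
  /-- increment register `r` -/
  | succ (r : ℕ)
  /-- copy register `s` to register `r` -/
  | copy (r s : ℕ)
  | seq (p q : Prog)
  /-- repeat `p` while the registers `r` and `s` differ -/
  | loop (r s : ℕ) (p : Prog)

namespace Prog

open Function (update)

/-- `Exec p σ τ`: the program `p` started with register contents `σ` terminates with `τ`. -/
inductive Exec : Prog → (ℕ → ℕ) → (ℕ → ℕ) → Prop
  | zero (r σ) : Exec (zero r) σ (update σ r 0)
  | succ (r σ) : Exec (succ r) σ (update σ r (σ r + 1))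
  | copy (r s σ) : Exec (copy r s) σ (update σ r (σ s))
  | seq {p q σ τ ρ} : Exec p σ τ → Exec q τ ρ → Exec (seq p q) σ ρ
  | loop_done {r s p σ} : σ r = σ s → Exec (loop r s p) σ σ
  | loop_step {r s p σ τ ρ} : σ r ≠ σ s → Exec p σ τ → Exec (loop r s p) τ ρ →
      Exec (loop r s p) σ ρ

theorem Exec.loop_invariant {r s : ℕ} {p : Prog} {σ τ : ℕ → ℕ} (Inv : (ℕ → ℕ) → Prop)
    (hp : ∀ σ τ, Inv σ → σ r ≠ σ s → Exec p σ τ → Inv τ)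
    (h : Exec (loop r s p) σ τ) (hσ : Inv σ) : Inv τ ∧ τ r = τ s := by
  generalize hq : loop r s p = q at h
  induction h with
  | loop_done h => cases hq; exact ⟨hσ, h⟩
  | loop_step h h1 _ _ ih => cases hq; exact ih (hp _ _ hσ h h1) rfl
  | _ => cases hq

theorem exec_loop_of_measure {r s : ℕ} {p : Prog} (Inv : (ℕ → ℕ) → Prop) (m : (ℕ → ℕ) → ℕ)
    (hp : ∀ σ, Inv σ → σ r ≠ σ s → ∃ τ, Exec p σ τ ∧ Inv τ ∧ m τ < m σ)
    (σ : ℕ → ℕ) (hσ : Inv σ) : ∃ τ, Exec (loop r s p) σ τ := by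
  induction hm : m σ using Nat.strong_induction_on generalizing σ with
  | _ n ih =>
    by_cases h : σ r = σ s
    · exact ⟨σ, .loop_done h⟩
    · obtain ⟨τ, h1, h2, h3⟩ := hp σ hσ h
      obtain ⟨ρ, h4⟩ := ih _ (hm ▸ h3) τ h2 rfl
      exact ⟨ρ, .loop_step h h1 h4⟩

/-- `p` computes `f` from the argument registers `a` into the register `o`, and changes no other
register below `b`. -/
def ComputesAt {n : ℕ} (f : List.Vector ℕ n →. ℕ) (a : List.Vector ℕ n) (o b : ℕ) (p : Prog) :
    Prop :=
  ∀ σ : ℕ → ℕ,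
    (∀ τ, Exec p σ τ → τ o ∈ f (a.map σ) ∧ ∀ r < b, r ≠ o → τ r = σ r) ∧
    ((f (a.map σ)).Dom → ∃ τ, Exec p σ τ)

/-- The function `f` is computed by while programs, for every choice of the registers. -/
def Computes {n : ℕ} (f : List.Vector ℕ n →. ℕ) : Prop :=
  ∀ (a : List.Vector ℕ n) (o b : ℕ), (∀ i, a.get i < b) → o < b → ∃ p, ComputesAt f a o b p

theorem map_congr_of_lt {n b : ℕ} {a : List.Vector ℕ n} (ha : ∀ i, a.get i < b) {σ τ : ℕ → ℕ}
    (h : ∀ r < b, τ r = σ r) : a.map τ = a.map σ := by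
  ext i
  simp [h _ (ha i)]

theorem exec_zero_iff {r : ℕ} {σ τ : ℕ → ℕ} : Exec (zero r) σ τ ↔ τ = update σ r 0 :=
  ⟨fun h => by cases h; rfl, fun h => h ▸ .zero r σ⟩

theorem exec_succ_iff {r : ℕ} {σ τ : ℕ → ℕ} :
    Exec (succ r) σ τ ↔ τ = update σ r (σ r + 1) :=
  ⟨fun h => by cases h; rfl, fun h => h ▸ .succ r σ⟩

theorem exec_copy_iff {r s : ℕ} {σ τ : ℕ → ℕ} :
    Exec (copy r s) σ τ ↔ τ = update σ r (σ s) :=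
  ⟨fun h => by cases h; rfl, fun h => h ▸ .copy r s σ⟩

theorem exec_seq_iff {p q : Prog} {σ ρ : ℕ → ℕ} :
    Exec (seq p q) σ ρ ↔ ∃ τ, Exec p σ τ ∧ Exec q τ ρ :=
  ⟨fun h => by cases h with | seq h1 h2 => exact ⟨_, h1, h2⟩, fun ⟨_, h1, h2⟩ => .seq h1 h2⟩

theorem Computes.zero : Computes (n := 0) fun _ => Part.some 0 := by
  intro a o b _ _
  refine ⟨.zero o, fun σ => ⟨fun τ h => ?_, fun _ => ⟨_, .zero o σ⟩⟩⟩
  rw [exec_zero_iff] at h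
  subst h
  exact ⟨by simp, fun r _ hr => by simp [hr]⟩

theorem Computes.succ : Computes (n := 1) fun v => Part.some (v.head + 1) := by
  intro a o b _ _
  refine ⟨.seq (.copy o a.head) (.succ o), fun σ => ⟨fun τ h => ?_, fun _ =>
    ⟨_, .seq (.copy _ _ _) (.succ _ _)⟩⟩⟩
  simp only [exec_seq_iff, exec_copy_iff, exec_succ_iff] at h
  obtain ⟨_, rfl, rfl⟩ := h
  exact ⟨by simp, fun r _ hr => by simp [hr]⟩

theorem Computes.get {n : ℕ} (i : Fin n) : Computes fun v => Part.some (v.get i) := by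
  intro a o b _ _
  refine ⟨.copy o (a.get i), fun σ => ⟨fun τ h => ?_, fun _ => ⟨_, .copy _ _ _⟩⟩⟩
  rw [exec_copy_iff] at h
  subst h
  exact ⟨by simp, fun r _ hr => by simp [hr]⟩

/-- The results go to registers `b`, `b + 1`, …; each new program treats the results already stored
as protected, by raising its bound. -/
theorem exists_prog_tuple {m : ℕ} (a : List.Vector ℕ m) (b : ℕ) (ha : ∀ i, a.get i < b) :
    ∀ {n : ℕ} (g : Fin n → List.Vector ℕ m →. ℕ), (∀ i, Computes (g i)) →
      ∃ p, ∀ σ : ℕ → ℕ,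
        (∀ τ, Exec p σ τ → (∀ i : Fin n, τ (b + i) ∈ g i (a.map σ)) ∧ ∀ r < b, τ r = σ r) ∧
        ((∀ i, (g i (a.map σ)).Dom) → ∃ τ, Exec p σ τ) := by
  intro n
  induction n with
  | zero =>
    intro g _
    -- With nothing to compute, any terminating program that spares the registers below `b` will do.
    refine ⟨.zero b, fun σ => ⟨fun τ h => ?_, fun _ => ⟨_, .zero _ _⟩⟩⟩
    rw [exec_zero_iff] at h
    subst h
    exact ⟨fun i => i.elim0, fun r hr => by simp [hr.ne]⟩
  | succ n ih =>
    intro g hg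
    obtain ⟨p, hp⟩ := ih (fun i => g i.castSucc) fun i => hg _
    obtain ⟨q, hq⟩ := hg (Fin.last n) a (b + n) (b + n + 1)
      (fun i => (ha i).trans_le (by omega)) (by omega)
    refine ⟨.seq p q, fun σ => ⟨fun ρ h => ?_, fun h => ?_⟩⟩
    · rw [exec_seq_iff] at h
      obtain ⟨τ, h1, h2⟩ := h
      obtain ⟨h3, h4⟩ := (hp σ).1 τ h1
      obtain ⟨h5, h6⟩ := (hq τ).1 ρ h2
      rw [map_congr_of_lt ha h4] at h5
      refine ⟨fun i => ?_, fun r hr => ?_⟩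
      · induction i using Fin.lastCases with
        | last => simpa using h5
        | cast i =>
          have := h6 (b + i) (by omega) (by omega)
          simpa [this] using h3 i
      · rw [h6 r (by omega) (by omega), h4 r hr]
    · obtain ⟨τ, h1⟩ := (hp σ).2 fun i => h _
      obtain ⟨ρ, h2⟩ := (hq τ).2 (by
        rw [map_congr_of_lt ha ((hp σ).1 τ h1).2]
        exact h _)
      exact ⟨ρ, .seq h1 h2⟩

theorem mem_mOfFn {α : Type*} : ∀ {n : ℕ} (g : Fin n → Part α) (w : List.Vector α n),
    w ∈ List.Vector.mOfFn g ↔ ∀ i, w.get i ∈ g i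
  | 0, g, w => by
    simp [List.Vector.mOfFn, List.Vector.eq_nil w]
  | n + 1, g, w => by
    rw [← List.Vector.cons_head_tail w]
    generalize w.head = x
    generalize w.tail = y
    simp only [List.Vector.mOfFn, Part.pure_eq_some, Part.bind_eq_bind, Part.mem_bind_iff,
      Part.mem_some_iff, Fin.forall_fin_succ, List.Vector.get_zero, List.Vector.head_cons,
      List.Vector.get_cons_succ]
    constructor
    · rintro ⟨x', hx, y', hy, h⟩
      have h1 := congrArg List.Vector.head h
      have h2 := congrArg List.Vector.tail h
      simp only [List.Vector.head_cons, List.Vector.tail_cons] at h1 h2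
      subst h1 h2
      exact ⟨hx, (mem_mOfFn _ _).1 hy⟩
    · rintro ⟨hx, hy⟩
      exact ⟨x, hx, y, (mem_mOfFn _ _).2 hy, rfl⟩

theorem Computes.comp {m n : ℕ} {f : List.Vector ℕ n →. ℕ} (g : Fin n → List.Vector ℕ m →. ℕ)
    (hf : Computes f) (hg : ∀ i, Computes (g i)) :
    Computes fun v => (List.Vector.mOfFn fun i => g i v) >>= f := by
  intro a o b ha ho
  obtain ⟨p, hp⟩ := exists_prog_tuple a b ha g hg
  obtain ⟨q, hq⟩ := hf (List.Vector.ofFn fun i : Fin n => b + i) o (b + n) (by simp) (by omega)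
  refine ⟨.seq p q, fun σ => ⟨fun ρ h => ?_, fun h => ?_⟩⟩
  · rw [exec_seq_iff] at h
    obtain ⟨τ, h1, h2⟩ := h
    obtain ⟨h3, h4⟩ := (hp σ).1 τ h1
    obtain ⟨h5, h6⟩ := (hq τ).1 ρ h2
    refine ⟨?_, fun r hr hro => ?_⟩
    · exact Part.mem_bind_iff.2 ⟨_, (mem_mOfFn _ _).2 (by simpa using h3), h5⟩
    · rw [h6 r (by omega) hro, h4 r hr]
  · rw [Part.dom_iff_mem] at h
    obtain ⟨y, hy⟩ := h
    obtain ⟨w, hw, hy⟩ := Part.mem_bind_iff.1 hy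
    rw [mem_mOfFn] at hw
    obtain ⟨τ, h1⟩ := (hp σ).2 fun i => Part.dom_iff_mem.2 ⟨_, hw i⟩
    have h3 := ((hp σ).1 τ h1).1
    have hw' : (List.Vector.ofFn fun i : Fin n => b + (i : ℕ)).map τ = w := by
      ext i
      simpa using Part.mem_unique (h3 i) (hw i)
    obtain ⟨ρ, h2⟩ := (hq τ).2 (by rw [hw']; exact Part.dom_iff_mem.2 ⟨_, hy⟩)
    exact ⟨ρ, .seq h1 h2⟩

theorem Computes.prec {n : ℕ} {f : List.Vector ℕ n → ℕ} {g : List.Vector ℕ (n + 2) → ℕ}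
    (hf : Computes fun v => Part.some (f v)) (hg : Computes fun v => Part.some (g v)) :
    Computes fun v : List.Vector ℕ (n + 1) =>
      Part.some (v.head.rec (f v.tail) fun y ih => g (y ::ᵥ ih ::ᵥ v.tail) : ℕ) := by
  intro a o b ha ho
  have hat : ∀ i, a.tail.get i < b := fun i => by rw [List.Vector.get_tail_succ]; exact ha _
  have hah : a.head < b := by rw [← List.Vector.get_zero]; exact ha 0
  -- Register `b` counts the rounds and `b + 1` holds the current value, which `g` reads and
  -- overwrites. The output `o` is written only at the end, since it may be one of the arguments.
  obtain ⟨p, hp⟩ := hf a.tail (b + 1) (b + 2) (fun i => (hat i).trans_le (by omega)) (by omega)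
  obtain ⟨q, hq⟩ := hg (b ::ᵥ (b + 1) ::ᵥ a.tail) (b + 1) (b + 2) (by
    intro i
    refine Fin.cases (by simp) (fun i => ?_) i
    rw [List.Vector.get_cons_succ]
    refine Fin.cases (by simp) (fun i => ?_) i
    simpa using (hat i).trans_le (by omega)) (by omega)
  have hstep : ∀ σ τ ρ, Exec q σ τ → Exec (.succ b) τ ρ → ρ b = σ b + 1 ∧
      ρ (b + 1) = g (σ b ::ᵥ σ (b + 1) ::ᵥ a.tail.map σ) ∧ ∀ r < b, ρ r = σ r := by
    intro σ τ ρ h1 h2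
    obtain ⟨h3, h4⟩ := (hq σ).1 τ h1
    rw [exec_succ_iff] at h2
    subst h2
    refine ⟨by simp [h4 b], by simpa using h3, fun r hr => ?_⟩
    rw [Function.update_of_ne (by omega), h4 r (by omega) (by omega)]
  let F (σ : ℕ → ℕ) (k : ℕ) : ℕ :=
    k.rec (f (a.tail.map σ)) fun y ih => g (y ::ᵥ ih ::ᵥ a.tail.map σ)
  let Inv (σ τ : ℕ → ℕ) : Prop :=
    τ b ≤ σ a.head ∧ τ (b + 1) = F σ (τ b) ∧ ∀ r < b, τ r = σ r
  have hinv : ∀ σ σ₁ τ ρ, Inv σ σ₁ → σ₁ b ≠ σ₁ a.head → Exec q σ₁ τ → Exec (.succ b) τ ρ →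
      Inv σ ρ ∧ ρ b = σ₁ b + 1 := by
    intro σ σ₁ τ ρ ⟨h1, h2, h3⟩ hne h4 h5
    obtain ⟨h6, h7, h8⟩ := hstep _ _ _ h4 h5
    rw [h3 _ hah] at hne
    refine ⟨⟨by omega, ?_, fun r hr => by rw [h8 r hr, h3 r hr]⟩, h6⟩
    rw [h7, h6, h2, map_congr_of_lt hat h3]
  have hinit : ∀ σ τ, Exec p (update σ b 0) τ → Inv σ τ := by
    intro σ τ h
    obtain ⟨h1, h2⟩ := (hp _).1 τ h
    have h0 : ∀ r < b, update σ b 0 r = σ r := fun r hr => by simp [hr.ne]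
    have hb : τ b = 0 := by rw [h2 b (by omega) (by omega)]; simp
    rw [map_congr_of_lt hat h0, Part.mem_some_iff] at h1
    refine ⟨by omega, by rw [hb, h1]; rfl, fun r hr => ?_⟩
    rw [h2 r (by omega) (by omega), h0 r hr]
  refine ⟨.seq (.zero b) (.seq p (.seq (.loop b a.head (.seq q (.succ b))) (.copy o (b + 1)))),
    fun σ => ⟨fun ρ h => ?_, fun _ => ?_⟩⟩
  · simp only [exec_seq_iff, exec_zero_iff, exec_copy_iff] at h
    obtain ⟨_, rfl, τ, h1, τ', h2, rfl⟩ := h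
    obtain ⟨⟨h3, h4, h5⟩, h6⟩ := h2.loop_invariant (Inv σ) (by
      intro σ₁ ρ hσ hne h
      obtain ⟨τ, h3, h4⟩ := exec_seq_iff.1 h
      exact (hinv _ _ _ _ hσ hne h3 h4).1) (hinit σ τ h1)
    refine ⟨?_, fun r hr hro => by simp [hro, h5 r hr]⟩
    rw [h5 _ hah] at h6
    simp only [Function.update_self, Part.mem_some_iff, h4, h6]
    simp [F]
  · obtain ⟨τ, h1⟩ := (hp (update σ b 0)).2 trivial
    obtain ⟨ρ, h2⟩ := exec_loop_of_measure (p := .seq q (.succ b)) (r := b) (s := a.head) (Inv σ)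
      (fun τ => σ a.head - τ b) (by
        intro σ₁ hσ hne
        obtain ⟨τ, h3⟩ := (hq σ₁).2 trivial
        obtain ⟨h4, h5⟩ := hinv _ _ _ _ hσ hne h3 (.succ _ _)
        refine ⟨_, .seq h3 (.succ _ _), h4, ?_⟩
        have := h4.1
        omega) τ (hinit σ τ h1)
    exact ⟨_, .seq (.zero _ _) (.seq h1 (.seq h2 (.copy _ _ _)))⟩

theorem Computes.rfind {n : ℕ} {f : List.Vector ℕ (n + 1) → ℕ}
    (hf : Computes fun v => Part.some (f v)) :
    Computes fun v : List.Vector ℕ n => Nat.rfind fun k => Part.some (f (k ::ᵥ v) = 0) := by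
  intro a o b ha ho
  -- Register `b` holds the candidate, `b + 1` the constant 0 for the loop test, and `b + 2` the
  -- value of `f` at the candidate.
  obtain ⟨p, hp⟩ := hf (b ::ᵥ a) (b + 2) (b + 3) (by
    intro i
    refine Fin.cases (by simp) (fun i => ?_) i
    simpa using (ha i).trans_le (by omega)) (by omega)
  have hrun : ∀ σ τ, Exec p σ τ → τ b = σ b ∧ τ (b + 1) = σ (b + 1) ∧
      τ (b + 2) = f (σ b ::ᵥ a.map σ) ∧ ∀ r < b, τ r = σ r := by
    intro σ τ h
    obtain ⟨h1, h2⟩ := (hp σ).1 τ h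
    exact ⟨h2 _ (by omega) (by omega), h2 _ (by omega) (by omega), by simpa using h1,
      fun r hr => h2 _ (by omega) (by omega)⟩
  let Inv (σ τ : ℕ → ℕ) : Prop := τ (b + 1) = 0 ∧ τ (b + 2) = f (τ b ::ᵥ a.map σ) ∧
    (∀ j < τ b, f (j ::ᵥ a.map σ) ≠ 0) ∧ ∀ r < b, τ r = σ r
  have hinv : ∀ σ σ₁ τ, Inv σ σ₁ → σ₁ (b + 2) ≠ σ₁ (b + 1) →
      Exec p (update σ₁ b (σ₁ b + 1)) τ → Inv σ τ ∧ τ b = σ₁ b + 1 := by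
    intro σ σ₁ τ ⟨h1, h2, h3, h4⟩ hne h
    obtain ⟨h5, h6, h7, h8⟩ := hrun _ _ h
    have h9 : ∀ r < b, update σ₁ b (σ₁ b + 1) r = σ r := fun r hr => by simp [hr.ne, h4 r hr]
    rw [map_congr_of_lt ha h9] at h7
    simp only [Function.update_self] at h5 h7
    refine ⟨⟨by rw [h6]; simpa using h1, by rw [h7, h5], fun j hj => ?_,
      fun r hr => by rw [h8 r hr, h9 r hr]⟩, h5⟩
    rcases (by omega : j < σ₁ b ∨ j = σ₁ b) with hj | rfl
    · exact h3 j hj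
    · rw [← h2, ← h1]; exact hne
  have hinit : ∀ σ τ, Exec p (update (update σ b 0) (b + 1) 0) τ → Inv σ τ := by
    intro σ τ h
    obtain ⟨h5, h6, h7, h8⟩ := hrun _ _ h
    have h9 : ∀ r < b, update (update σ b 0) (b + 1) 0 r = σ r := fun r hr => by
      rw [Function.update_of_ne (by omega), Function.update_of_ne (by omega)]
    rw [map_congr_of_lt ha h9] at h7
    simp only [Function.update_self, ne_eq, Nat.left_eq_add, one_ne_zero, not_false_eq_true,
      Function.update_of_ne] at h5 h6 h7
    exact ⟨h6, by rw [h7, h5], fun j hj => by omega, fun r hr => by rw [h8 r hr, h9 r hr]⟩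
  refine ⟨.seq (.zero b) (.seq (.zero (b + 1)) (.seq p (.seq
    (.loop (b + 2) (b + 1) (.seq (.succ b) p)) (.copy o b)))), fun σ => ⟨fun ρ h => ?_, fun h => ?_⟩⟩
  · simp only [exec_seq_iff, exec_zero_iff, exec_copy_iff] at h
    obtain ⟨_, rfl, _, rfl, τ, h1, τ', h2, rfl⟩ := h
    obtain ⟨⟨h3, h4, h5, h6⟩, h7⟩ := h2.loop_invariant (Inv σ) (by
      intro σ₁ ρ hσ hne h
      obtain ⟨τ, h3, h4⟩ := exec_seq_iff.1 h
      rw [exec_succ_iff] at h3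
      subst h3
      exact (hinv _ _ _ hσ hne h4).1) (hinit σ τ h1)
    refine ⟨?_, fun r hr hro => by simp [hro, h6 r hr]⟩
    rw [h3, h4] at h7
    rw [Function.update_self]
    exact Nat.mem_rfind.2 ⟨by simp [h7], fun {m} hm => by simp [h5 m hm]⟩
  · obtain ⟨k, hk⟩ := Part.dom_iff_mem.1 h
    obtain ⟨hk, -⟩ := Nat.mem_rfind.1 hk
    simp only [Part.mem_some_iff, Bool.true_eq, decide_eq_true_eq] at hk
    obtain ⟨τ, h1⟩ := (hp (update (update σ b 0) (b + 1) 0)).2 trivial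
    -- The search cannot pass a known zero `k` of `f`, so `k + 1 - τ b` strictly decreases.
    obtain ⟨ρ, h2⟩ := exec_loop_of_measure (p := .seq (.succ b) p) (r := b + 2) (s := b + 1)
      (Inv σ) (fun τ => k + 1 - τ b) (by
        intro σ₁ hσ hne
        obtain ⟨τ, h3⟩ := (hp (update σ₁ b (σ₁ b + 1))).2 trivial
        obtain ⟨h4, h5⟩ := hinv _ _ _ hσ hne h3
        refine ⟨_, .seq (.succ _ _) h3, h4, ?_⟩
        have : ¬ k < τ b := fun hlt => h4.2.2.1 k hlt hk
        omega) τ (hinit σ τ h1)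
    exact ⟨_, .seq (.zero _ _) (.seq (.zero _ _) (.seq h1 (.seq h2 (.copy _ _ _))))⟩

theorem Computes.of_primrec' {n : ℕ} {f : List.Vector ℕ n → ℕ} (hf : Nat.Primrec' f) :
    Computes fun v => Part.some (f v) := by
  induction hf with
  | zero => exact .zero
  | succ => exact .succ
  | get i => exact .get i
  | @comp m n f g _ _ ihf ihg =>
    have := Computes.comp _ ihf ihg
    simpa only [Vector.mOfFn_part_some, Part.bind_eq_bind, Part.bind_some] using this
  | prec _ _ ihf ihg => exact .prec ihf ihg

theorem Computes.of_partrec' {n : ℕ} {f : List.Vector ℕ n →. ℕ} (hf : Nat.Partrec' f) :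
    Computes f := by
  induction hf with
  | prim hf => exact .of_primrec' hf
  | comp g _ _ ihf ihg => exact .comp g ihf ihg
  | rfind _ ih => exact .rfind ih

/-- Every unary partial recursive function has a while program that halts on exactly those inputs
(placed in register `0`, the other registers being `0`) where the function is defined. -/
theorem exists_exec_iff_dom {f : ℕ →. ℕ} (hf : Partrec f) :
    ∃ p : Prog, ∀ n, (∃ τ, Exec p (update (fun _ => 0) 0 n) τ) ↔ (f n).Dom := by
  obtain ⟨p, hp⟩ := Computes.of_partrec' (Nat.Partrec'.part_iff₁.2 hf) (0 ::ᵥ .nil) 1 2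
    (by simp) (by simp)
  refine ⟨p, fun n => ⟨fun ⟨τ, h⟩ => ?_, fun h => ?_⟩⟩
  · have := ((hp _).1 τ h).1
    exact Part.dom_iff_mem.2 ⟨_, by simpa using this⟩
  · exact (hp _).2 (by simpa using h)

end Prog
end RealDiffLogic

/-! ### Small-step execution and its finitely many control states. -/

namespace RealDiffLogic

namespace Prog

open Function (update)

/-- One step of the execution of a list of programs that are to be run one after the other. -/
def step : List Prog × (ℕ → ℕ) → List Prog × (ℕ → ℕ)
  | ([], σ) => ([], σ)
  | (zero r :: k, σ) => (k, update σ r 0)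
  | (succ r :: k, σ) => (k, update σ r (σ r + 1))
  | (copy r s :: k, σ) => (k, update σ r (σ s))
  | (seq p q :: k, σ) => (p :: q :: k, σ)
  | (loop r s p :: k, σ) => if σ r = σ s then (k, σ) else (p :: loop r s p :: k, σ)

theorem Exec.exists_iterate_step {p : Prog} {σ τ : ℕ → ℕ} (h : Exec p σ τ) (k : List Prog) :
    ∃ n, step^[n] (p :: k, σ) = (k, τ) := by
  induction h generalizing k with
  | zero | succ | copy => exact ⟨1, rfl⟩
  | @seq p q _ _ _ _ _ ih1 ih2 =>
    obtain ⟨m, hm⟩ := ih1 (q :: k)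
    obtain ⟨n, hn⟩ := ih2 k
    refine ⟨n + m + 1, ?_⟩
    rw [Function.iterate_succ_apply, step, Function.iterate_add_apply, hm, hn]
  | loop_done h => exact ⟨1, by simp [step, h]⟩
  | @loop_step r s p _ _ _ h _ _ ih1 ih2 =>
    obtain ⟨m, hm⟩ := ih1 (loop r s p :: k)
    obtain ⟨n, hn⟩ := ih2 k
    refine ⟨n + m + 1, ?_⟩
    rw [Function.iterate_succ_apply, step, if_neg h, Function.iterate_add_apply, hm, hn]

/-- Before the whole list is used up, its head must have been completed. The strict bound `m < n`
lets the induction hypothesis be applied again to the remainder, as sequences and loops require. -/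
theorem exists_exec_of_iterate_step (n : ℕ) (p : Prog) (k : List Prog) (σ : ℕ → ℕ)
    (h : (step^[n] (p :: k, σ)).1 = []) :
    ∃ τ, ∃ m < n, Exec p σ τ ∧ (step^[m] (k, τ)).1 = [] := by
  induction n using Nat.strong_induction_on generalizing p k σ with
  | _ n ih =>
    cases n with
    | zero => simp at h
    | succ n =>
      rw [Function.iterate_succ_apply] at h
      cases p with
      | zero r => exact ⟨_, n, by omega, .zero _ _, h⟩
      | succ r => exact ⟨_, n, by omega, .succ _ _, h⟩
      | copy r s => exact ⟨_, n, by omega, .copy _ _ _, h⟩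
      | seq p q =>
        obtain ⟨τ, m, hm, h1, h2⟩ := ih n (by omega) p (q :: k) σ h
        obtain ⟨ρ, l, hl, h3, h4⟩ := ih m (by omega) q k τ h2
        exact ⟨ρ, l, by omega, .seq h1 h3, h4⟩
      | loop r s p =>
        rw [step] at h
        split_ifs at h with hrs
        · exact ⟨σ, n, by omega, .loop_done hrs, h⟩
        · obtain ⟨τ, m, hm, h1, h2⟩ := ih n (by omega) p (loop r s p :: k) σ h
          obtain ⟨ρ, l, hl, h3, h4⟩ := ih m (by omega) (loop r s p) k τ h2
          exact ⟨ρ, l, by omega, .loop_step hrs h1 h3, h4⟩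

theorem exists_exec_iff_iterate_step {p : Prog} {σ : ℕ → ℕ} :
    (∃ τ, Exec p σ τ) ↔ ∃ n, (step^[n] ([p], σ)).1 = [] := by
  constructor
  · rintro ⟨τ, h⟩
    obtain ⟨n, hn⟩ := h.exists_iterate_step []
    exact ⟨n, by rw [hn]⟩
  · rintro ⟨n, hn⟩
    obtain ⟨τ, m, -, h, -⟩ := exists_exec_of_iterate_step n p [] σ hn
    exact ⟨τ, h⟩

/-- The lists of programs that may remain after one step. -/
def successors : List Prog → Set (List Prog)
  | [] => {[]}
  | zero _ :: k => {k}
  | succ _ :: k => {k}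
  | copy _ _ :: k => {k}
  | seq p q :: k => {p :: q :: k}
  | loop r s p :: k => {k, p :: loop r s p :: k}

theorem step_mem_successors (l : List Prog) (σ : ℕ → ℕ) : (step (l, σ)).1 ∈ successors l := by
  rcases l with _ | ⟨_ | _ | _ | _ | _, k⟩ <;> simp only [step, successors, Set.mem_singleton_iff]
  split_ifs <;> simp

/-- The continuation `k` is exempt from closure. This makes loops finite: the body is run with the
loop itself as continuation, and closing up adds just that one list. -/
theorem exists_finite_successors_subset_insert (p : Prog) (k : List Prog) :
    ∃ T : Set (List Prog), T.Finite ∧ p :: k ∈ T ∧ ∀ l ∈ T, successors l ⊆ insert k T := by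
  induction p generalizing k with
  | zero | succ | copy =>
    refine ⟨{_ :: k}, Set.finite_singleton _, rfl, ?_⟩
    rintro l rfl
    simp [successors]
  | seq p q ihp ihq =>
    obtain ⟨T, hT, h1, h2⟩ := ihp (q :: k)
    obtain ⟨U, hU, h3, h4⟩ := ihq k
    refine ⟨insert (seq p q :: k) (T ∪ U), (hT.union hU).insert _, by simp, ?_⟩
    rintro l (rfl | hl | hl)
    · simp [successors, h1]
    · refine (h2 l hl).trans (Set.insert_subset (by simp [h3]) ?_)
      exact fun x hx => by simp [hx]
    · exact (h4 l hl).trans (Set.insert_subset_insert fun x hx => by simp [hx])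
  | loop r s p ih =>
    obtain ⟨T, hT, h1, h2⟩ := ih (loop r s p :: k)
    refine ⟨insert (loop r s p :: k) T, hT.insert _, by simp, ?_⟩
    rintro l (rfl | hl)
    · rintro x (rfl | rfl)
      · simp
      · simp [h1]
    · exact (h2 l hl).trans fun x hx => by simpa using .inr hx

theorem exists_finset_successors_subset (p : Prog) :
    ∃ T : Finset (List Prog), [p] ∈ T ∧ ∀ l ∈ T, successors l ⊆ T := by
  obtain ⟨T, hT, h1, h2⟩ := exists_finite_successors_subset_insert p []
  refine ⟨(hT.insert []).toFinset, by simp [h1], fun l hl => ?_⟩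
  rw [Set.Finite.mem_toFinset] at hl
  rw [Set.Finite.coe_toFinset]
  rcases hl with rfl | hl
  · simp [successors]
  · exact h2 l hl

/-- A bound for the registers on which the first step of a list of programs depends. -/
def registerBound : List Prog → ℕ
  | zero r :: _ => r + 1
  | succ r :: _ => r + 1
  | copy r s :: _ => r + s + 1
  | loop r s _ :: _ => r + s + 1
  | _ => 0

end Prog

/-! ### Formulas that describe computation histories. -/

namespace Formula

/-- The conjunction of a list of formulas. -/
def conj : List Formula → Formula
  | [] => order .eq 0 0
  | φ :: l => and φ (conj l)

theorem holds_conj {I : ℕ → Set ℝ} {v : ℕ → ℝ} {l : List Formula} :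
    Holds I (conj l) v ↔ ∀ φ ∈ l, Holds I φ v := by
  induction l with
  | nil => simp [conj, Holds, Cmp.Holds]
  | cons φ l ih => simp [conj, Holds, ih]

theorem holds_conj_map {ι : Type*} {I : ℕ → Set ℝ} {v : ℕ → ℝ} {l : List ι} {f : ι → Formula} :
    Holds I (conj (l.map f)) v ↔ ∀ i ∈ l, Holds I (f i) v := by
  rw [holds_conj, List.forall_mem_map]

theorem preds_conj_subset {s : Finset ℕ} {l : List Formula} (h : ∀ φ ∈ l, φ.preds ⊆ s) :
    (conj l).preds ⊆ s := by
  induction l with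
  | nil => simp [conj, preds]
  | cons φ l ih =>
    rw [List.forall_mem_cons] at h
    exact Finset.union_subset h.1 (ih h.2)

/-- The point at distance `j` above `x` satisfies the predicate `p`. -/
def shifted (p x : ℕ) (j : ℕ) : Formula :=
  ex 4 (and (diff .eq 4 x j) (pred p 4))

/-- Variable 4 is bound in `shifted`, hence the side condition. Throughout, variables 0 to 3 name
points of the grid, while 4 and 5 are auxiliary. -/
theorem holds_shifted {I : ℕ → Set ℝ} {v : ℕ → ℝ} {p x j : ℕ} (hx : x ≠ 4) :
    Holds I (shifted p x j) v ↔ v x + j ∈ I p := by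
  simp only [shifted, Holds, Cmp.Holds, Function.update_self, Function.update_of_ne hx,
    sub_eq_iff_eq_add, Int.cast_natCast, exists_eq_left, add_comm]

/-- The point `x` lies in `[w, w + 1)`. -/
def inRow (w x : ℕ) : Formula :=
  and (order .le w x) (diff .lt x w 1)

theorem holds_inRow {I : ℕ → Set ℝ} {v : ℕ → ℝ} {w x : ℕ} :
    Holds I (inRow w x) v ↔ v x ∈ Set.Ico (v w) (v w + 1) := by
  simp only [inRow, Holds, Cmp.Holds, Set.mem_Ico, Int.cast_one, sub_lt_iff_lt_add, add_comm]

end Formula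

/-- The data attached to the points of the grid: a diagonal marker, the values of the registers
and the programs that remain to be run. -/
inductive Sym : Type
  | diag
  | reg (r : ℕ)
  | state (l : List Prog)

/-- A layout of computation histories in a set of reals: the predicate symbol that stands for the
set, the distance of consecutive rows of the grid, and the positions of the data. -/
structure Layout where
  pred : ℕ
  period : ℕ
  index : Sym → ℕ

namespace Layout

open Formula

/-- Grid points are those points `x` for which `x` and `x + 1` both belong to `P`. -/
def Grid (P : Set ℝ) (x : ℝ) : Prop := x ∈ P ∧ x + 1 ∈ P

/-- `y` is the successor of `x` among the grid points. -/
def Next (P : Set ℝ) (x y : ℝ) : Prop :=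
  Grid P x ∧ Grid P y ∧ x < y ∧ ∀ z, x < z → z < y → ¬ Grid P z

variable (c : Layout)

/-- The point `x` carries the datum `s`. -/
def Data (P : Set ℝ) (s : Sym) (x : ℝ) : Prop := x + (3 + 2 * c.index s : ℕ) ∈ P

/-- The point `x + j` is a grid point. -/
def grid (j x : ℕ) : Formula := and (shifted c.pred x j) (shifted c.pred x (j + 1))

/-- The point `x + j` carries the datum `s`. -/
def data (s : Sym) (j x : ℕ) : Formula := shifted c.pred x (j + (3 + 2 * c.index s))

/-- `y` is the successor of `x` among the grid points. -/
def next (x y : ℕ) : Formula :=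
  and (and (c.grid 0 x) (c.grid 0 y)) (and (order .lt x y)
    (all 5 (imp (order .lt x 5) (imp (order .lt 5 y) (not (c.grid 0 5))))))

theorem holds_grid {I : ℕ → Set ℝ} {v : ℕ → ℝ} {j x : ℕ} (hx : x ≠ 4) :
    Holds I (c.grid j x) v ↔ Grid (I c.pred) (v x + j) := by
  simp [grid, Holds, holds_shifted hx, Grid, add_assoc]

theorem holds_data {I : ℕ → Set ℝ} {v : ℕ → ℝ} {s : Sym} {j x : ℕ} (hx : x ≠ 4) :
    Holds I (c.data s j x) v ↔ c.Data (I c.pred) s (v x + j) := by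
  simp [data, holds_shifted hx, Data, add_assoc]

theorem holds_next {I : ℕ → Set ℝ} {v : ℕ → ℝ} {x y : ℕ} (hx : x < 4) (hy : y < 4) :
    Holds I (c.next x y) v ↔ Next (I c.pred) (v x) (v y) := by
  have hx5 : x ≠ 5 := by omega
  have hy5 : y ≠ 5 := by omega
  simp [next, Holds, c.holds_grid hx.ne, c.holds_grid hy.ne, c.holds_grid (show 5 ≠ 4 by simp),
    Next, Cmp.Holds, hx5, hy5, and_assoc]

/-- Passage from the state `l` to the state `k`. -/
def goto (l k : List Prog) : Formula :=
  all 1 (imp (c.grid 0 1) (imp (c.data (.state l) 0 1) (c.data (.state k) c.period 1)))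

/-- In the state `l`, register `r` is set to `0`. -/
def reset (l : List Prog) (r : ℕ) : Formula :=
  all 1 (imp (c.grid 0 1) (imp (c.data (.state l) 0 1) (c.data (.reg r) c.period 1)))

/-- In the state `l`, register `r` receives the value of register `s`. -/
def assign (l : List Prog) (r s : ℕ) : Formula :=
  all 1 (all 2 (imp (c.grid 0 1) (imp (c.data (.state l) 0 1) (imp (c.grid 0 2)
    (imp (inRow 1 2) (imp (c.data (.reg s) 0 2) (c.data (.reg r) c.period 2)))))))

/-- In the state `l`, register `r` is incremented. -/
def increment (l : List Prog) (r : ℕ) : Formula :=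
  all 1 (all 2 (all 3 (imp (c.grid 0 1) (imp (c.data (.state l) 0 1) (imp (c.next 2 3)
    (imp (inRow 1 2) (imp (c.data (.reg r) 0 2) (c.data (.reg r) c.period 3))))))))

/-- In the state `l`, the registers below `n` that satisfy `p` keep their values. -/
def keep (l : List Prog) (n : ℕ) (p : ℕ → Bool) : Formula :=
  conj (((List.range n).filter p).map fun r => c.assign l r r)

/-- Passage from the state `l` to the state `k` if the registers `r` and `s` agree. -/
def gotoEq (l k : List Prog) (r s : ℕ) : Formula :=
  all 1 (all 2 (imp (c.grid 0 1) (imp (c.data (.state l) 0 1) (imp (c.grid 0 2)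
    (imp (inRow 1 2) (imp (c.data (.reg r) 0 2) (imp (c.data (.reg s) 0 2)
      (c.data (.state k) c.period 1))))))))

/-- Passage from the state `l` to the state `k` if the registers `r` and `s` differ. -/
def gotoNe (l k : List Prog) (r s : ℕ) : Formula :=
  all 1 (all 2 (all 3 (imp (c.grid 0 1) (imp (c.data (.state l) 0 1) (imp (c.grid 0 2)
    (imp (c.grid 0 3) (imp (inRow 1 2) (imp (inRow 1 3) (imp (c.data (.reg r) 0 2)
      (imp (c.data (.reg s) 0 3) (imp (not (order .eq 2 3))
        (c.data (.state k) c.period 1))))))))))))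

/-- The effect of one step in the state `l` on the registers below `n`; the state `[]` is
forbidden. -/
def rule (n : ℕ) : List Prog → Formula
  | [] => all 1 (imp (c.grid 0 1) (not (c.data (.state []) 0 1)))
  | .zero r :: k =>
    let l := .zero r :: k
    conj [c.goto l k, c.reset l r, c.keep l n (· ≠ r)]
  | .succ r :: k =>
    let l := .succ r :: k
    conj [c.goto l k, c.increment l r, c.keep l n (· ≠ r)]
  | .copy r s :: k =>
    let l := .copy r s :: k
    conj [c.goto l k, c.assign l r s, c.keep l n (· ≠ r)]
  | .seq p q :: k =>
    let l := .seq p q :: k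
    conj [c.goto l (p :: q :: k), c.keep l n fun _ => true]
  | .loop r s p :: k =>
    let l := .loop r s p :: k
    conj [c.gotoEq l k r s, c.gotoNe l (p :: l) r s, c.keep l n fun _ => true]

/-- The first row of the grid starts at `0`. -/
def firstRow : Formula :=
  conj [c.grid 0 0, c.data .diag 0 0,
    all 2 (imp (inRow 0 2) (imp (c.grid 0 2) (ex 3 (and (c.next 2 3) (inRow 0 3)))))]

/-- In the row that starts at `1`, the state is `[p]`, register `0` holds the column of the
diagonal marker, and the other registers below `n` hold `0`. -/
def start (n : ℕ) (p : Prog) : Formula :=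
  conj [c.data (.state [p]) 0 1,
    all 2 (imp (c.grid 0 2) (imp (inRow 1 2) (imp (c.data .diag 0 2) (c.data (.reg 0) 0 2)))),
    conj (((List.range n).filter (· ≠ 0)).map fun r => c.data (.reg r) 0 1)]

/-- The grid is periodic. -/
def periodic : Formula := all 2 (iff (c.grid 0 2) (c.grid c.period 2))

/-- The diagonal markers propagate. -/
def diagonal : Formula :=
  all 2 (all 3 (imp (c.next 2 3) (imp (c.data .diag 0 2) (c.data .diag c.period 3))))

/-- The part of `history` that does not depend on the input. -/
def body (n : ℕ) (p : Prog) (T : List (List Prog)) : Formula :=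
  conj [c.firstRow, c.start n p, c.periodic, c.diagonal, conj (T.map (c.rule n))]

/-- A formula whose models contain the history of the computation of `p` on the input `m` and
do not contain the state `[]`. -/
def history (n : ℕ) (p : Prog) (T : List (List Prog)) (m : ℕ) : Formula :=
  ex 0 (ex 1 (and (diff .eq 1 0 ((c.period * m : ℕ) : ℤ)) (c.body n p T)))

/-! ### Predicate symbols of the formulas. -/

section Preds

theorem preds_grid (j x : ℕ) : (c.grid j x).preds = {c.pred} := by
  simp [grid, shifted, preds]

theorem preds_data (s : Sym) (j x : ℕ) : (c.data s j x).preds = {c.pred} := by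
  simp [data, shifted, preds]

theorem preds_next (x y : ℕ) : (c.next x y).preds = {c.pred} := by
  simp [next, preds, preds_grid]

theorem preds_inRow (x y : ℕ) : (inRow x y).preds = ∅ := rfl

theorem preds_assign (l : List Prog) (r s : ℕ) : (c.assign l r s).preds = {c.pred} := by
  simp [assign, preds, preds_grid, preds_data, preds_inRow]

theorem preds_keep (l : List Prog) (n : ℕ) (p : ℕ → Bool) : (c.keep l n p).preds ⊆ {c.pred} := by
  refine preds_conj_subset fun φ hφ => ?_
  obtain ⟨r, -, rfl⟩ := List.mem_map.1 hφ
  rw [preds_assign]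

theorem preds_rule (n : ℕ) (l : List Prog) : (c.rule n l).preds ⊆ {c.pred} := by
  rcases l with _ | ⟨_ | _ | _ | _ | _, k⟩
  · simp [rule, preds, preds_grid, preds_data]
  all_goals
    refine preds_conj_subset ?_
    simp [-Finset.subset_singleton_iff, goto, reset, assign, increment, gotoEq, gotoNe, preds,
      preds_grid, preds_data, preds_next, preds_inRow, preds_keep]

theorem preds_history (n : ℕ) (p : Prog) (T : List (List Prog)) (m : ℕ) :
    (c.history n p T m).preds ⊆ {c.pred} := by
  have h1 : (c.firstRow).preds ⊆ {c.pred} := preds_conj_subset (by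
    simp [preds, preds_grid, preds_data, preds_next, preds_inRow])
  have h2 : (c.start n p).preds ⊆ {c.pred} := preds_conj_subset (by
    simp only [List.forall_mem_cons]
    refine ⟨by simp [preds_data], by simp [preds, preds_data, preds_inRow, preds_grid],
      preds_conj_subset fun φ hφ => ?_, by simp⟩
    obtain ⟨r, -, rfl⟩ := List.mem_map.1 hφ
    rw [preds_data])
  have h3 : (conj (T.map (c.rule n))).preds ⊆ {c.pred} := preds_conj_subset fun φ hφ => by
    obtain ⟨r, -, rfl⟩ := List.mem_map.1 hφ
    exact c.preds_rule n r
  have h4 : (c.body n p T).preds ⊆ {c.pred} := preds_conj_subset (by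
    simp only [List.forall_mem_cons]
    refine ⟨h1, h2, ?_, ?_, h3, by simp⟩ <;>
    simp [periodic, diagonal, preds, preds_grid, preds_data, preds_next])
  simpa [history, preds] using h4

end Preds

/-! ### Meaning of the formulas. -/

section Holds

variable {I : ℕ → Set ℝ} {v : ℕ → ℝ}

theorem holds_goto {l k : List Prog} : Holds I (c.goto l k) v ↔
    ∀ w, Grid (I c.pred) w → c.Data (I c.pred) (.state l) w →
      c.Data (I c.pred) (.state k) (w + c.period) := by
  simp [goto, Holds, holds_grid, holds_data]

theorem holds_reset {l : List Prog} {r : ℕ} : Holds I (c.reset l r) v ↔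
    ∀ w, Grid (I c.pred) w → c.Data (I c.pred) (.state l) w →
      c.Data (I c.pred) (.reg r) (w + c.period) := by
  simp [reset, Holds, holds_grid, holds_data]

theorem holds_assign {l : List Prog} {r s : ℕ} : Holds I (c.assign l r s) v ↔
    ∀ w x, Grid (I c.pred) w → c.Data (I c.pred) (.state l) w → Grid (I c.pred) x →
      x ∈ Set.Ico w (w + 1) → c.Data (I c.pred) (.reg s) x →
      c.Data (I c.pred) (.reg r) (x + c.period) := by
  simp [assign, Holds, holds_grid, holds_data, holds_inRow]

theorem holds_increment {l : List Prog} {r : ℕ} : Holds I (c.increment l r) v ↔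
    ∀ w x y, Grid (I c.pred) w → c.Data (I c.pred) (.state l) w → Next (I c.pred) x y →
      x ∈ Set.Ico w (w + 1) → c.Data (I c.pred) (.reg r) x →
      c.Data (I c.pred) (.reg r) (y + c.period) := by
  simp [increment, Holds, holds_grid, holds_data, holds_inRow, holds_next]

theorem holds_gotoEq {l k : List Prog} {r s : ℕ} : Holds I (c.gotoEq l k r s) v ↔
    ∀ w x, Grid (I c.pred) w → c.Data (I c.pred) (.state l) w → Grid (I c.pred) x →
      x ∈ Set.Ico w (w + 1) → c.Data (I c.pred) (.reg r) x → c.Data (I c.pred) (.reg s) x →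
      c.Data (I c.pred) (.state k) (w + c.period) := by
  simp [gotoEq, Holds, holds_grid, holds_data, holds_inRow]

theorem holds_gotoNe {l k : List Prog} {r s : ℕ} : Holds I (c.gotoNe l k r s) v ↔
    ∀ w x y, Grid (I c.pred) w → c.Data (I c.pred) (.state l) w → Grid (I c.pred) x →
      Grid (I c.pred) y → x ∈ Set.Ico w (w + 1) → y ∈ Set.Ico w (w + 1) →
      c.Data (I c.pred) (.reg r) x → c.Data (I c.pred) (.reg s) y → x ≠ y →
      c.Data (I c.pred) (.state k) (w + c.period) := by
  simp [gotoNe, Holds, holds_grid, holds_data, holds_inRow, Cmp.Holds]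

theorem holds_keep {l : List Prog} {n : ℕ} {p : ℕ → Bool} : Holds I (c.keep l n p) v ↔
    ∀ r < n, p r = true → Holds I (c.assign l r r) v := by
  simp [keep, holds_conj_map]

theorem holds_rule_nil {n : ℕ} : Holds I (c.rule n []) v ↔
    ∀ w, Grid (I c.pred) w → ¬ c.Data (I c.pred) (.state []) w := by
  simp [rule, Holds, holds_grid, holds_data]

theorem holds_firstRow : Holds I c.firstRow v ↔
    Grid (I c.pred) (v 0) ∧ c.Data (I c.pred) .diag (v 0) ∧
      ∀ x ∈ Set.Ico (v 0) (v 0 + 1), Grid (I c.pred) x →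
        ∃ y, Next (I c.pred) x y ∧ y ∈ Set.Ico (v 0) (v 0 + 1) := by
  simp [firstRow, holds_conj, Holds, holds_grid, holds_data, holds_inRow, holds_next]

theorem holds_start {n : ℕ} {p : Prog} : Holds I (c.start n p) v ↔
    c.Data (I c.pred) (.state [p]) (v 1) ∧
      (∀ x, Grid (I c.pred) x → x ∈ Set.Ico (v 1) (v 1 + 1) → c.Data (I c.pred) .diag x →
        c.Data (I c.pred) (.reg 0) x) ∧
      ∀ r < n, r ≠ 0 → c.Data (I c.pred) (.reg r) (v 1) := by
  rw [start, holds_conj]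
  simp only [List.forall_mem_cons, holds_conj_map]
  simp [Holds, holds_grid, holds_data, holds_inRow]

theorem holds_periodic : Holds I c.periodic v ↔
    ∀ x, Grid (I c.pred) x ↔ Grid (I c.pred) (x + c.period) := by
  simp [periodic, Holds, holds_grid]

theorem holds_diagonal : Holds I c.diagonal v ↔
    ∀ x y, Next (I c.pred) x y → c.Data (I c.pred) .diag x →
      c.Data (I c.pred) .diag (y + c.period) := by
  simp [diagonal, Holds, holds_data, holds_next]

theorem holds_body {n : ℕ} {p : Prog} {T : List (List Prog)} : Holds I (c.body n p T) v ↔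
    Holds I c.firstRow v ∧ Holds I (c.start n p) v ∧ Holds I c.periodic v ∧
      Holds I c.diagonal v ∧ ∀ l ∈ T, Holds I (c.rule n l) v := by
  simp [body, holds_conj]

theorem satisfiable_history {n : ℕ} {p : Prog} {T : List (List Prog)} {m : ℕ} :
    (c.history n p T m).Satisfiable ↔ ∃ (I : ℕ → Set ℝ) (v : ℕ → ℝ),
      v 1 = v 0 + (c.period * m : ℕ) ∧ Holds I (c.body n p T) v := by
  constructor
  · rintro ⟨I, v, a, b, h1, h2⟩
    refine ⟨I, _, ?_, h2⟩
    simp [Holds, Cmp.Holds] at h1 ⊢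
    linarith
  · rintro ⟨I, v, h1, h2⟩
    refine ⟨I, v, v 0, v 1, ?_, ?_⟩
    · simp [Holds, Cmp.Holds, h1]
    · simpa using h2

end Holds

end Layout
end RealDiffLogic

/-! ### Every model contains the true history. -/

namespace RealDiffLogic
namespace Layout
open Formula Prog
open Function (update)

variable (c : Layout)

/-- Successors are iterated from `x₀` without leaving the interval. The interval may contain further
grid points, for instance beyond the limit of the sequence; they are never used. -/
theorem exists_columns {P : Set ℝ} {x₀ : ℝ} (h0 : Grid P x₀)
    (h : ∀ x ∈ Set.Ico x₀ (x₀ + 1), Grid P x → ∃ y, Next P x y ∧ y ∈ Set.Ico x₀ (x₀ + 1)) :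
    ∃ y : ℕ → ℝ, y 0 = x₀ ∧ ∀ b, y b ∈ Set.Ico x₀ (x₀ + 1) ∧ Next P (y b) (y (b + 1)) := by
  choose! f hf using h
  have key : ∀ b : ℕ, f^[b] x₀ ∈ Set.Ico x₀ (x₀ + 1) ∧ Grid P (f^[b] x₀) := by
    intro b
    induction b with
    | zero => exact ⟨by simp, h0⟩
    | succ b ih =>
      rw [Function.iterate_succ_apply']
      obtain ⟨h1, h2⟩ := hf _ ih.1 ih.2
      exact ⟨h2, h1.2.1⟩
  refine ⟨fun b => f^[b] x₀, rfl, fun b => ⟨(key b).1, ?_⟩⟩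
  have := (hf _ (key b).1 (key b).2).1
  rwa [← Function.iterate_succ_apply' f] at this

/-- Both directions of periodicity matter: the backward one excludes new grid points between the
shifted ones. -/
theorem Next.add {P : Set ℝ} {d x y : ℝ} (hd : ∀ x, Grid P x ↔ Grid P (x + d))
    (h : Next P x y) : Next P (x + d) (y + d) := by
  obtain ⟨h1, h2, h3, h4⟩ := h
  refine ⟨(hd x).1 h1, (hd y).1 h2, by linarith, fun z hz1 hz2 hz => ?_⟩
  refine h4 (z - d) (by linarith) (by linarith) ((hd _).2 ?_)
  rwa [sub_add_cancel]

/-- A grid in a set of reals, with columns `y 0, y 1, …` inside an interval of length `1`. -/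
structure IsGrid (P : Set ℝ) (y : ℕ → ℝ) : Prop where
  mem_Ico : ∀ b, y b ∈ Set.Ico (y 0) (y 0 + 1)
  next : ∀ b, Next P (y b) (y (b + 1))
  periodic : ∀ x, Grid P x ↔ Grid P (x + c.period)

/-- The grid point in column `b` and row `a`. -/
def point (y : ℕ → ℝ) (b a : ℕ) : ℝ := y b + c.period * a

theorem point_succ (y : ℕ → ℝ) (b a : ℕ) : c.point y b (a + 1) = c.point y b a + c.period := by
  simp only [point, Nat.cast_add, Nat.cast_one]
  ring

variable {c} {P : Set ℝ} {y : ℕ → ℝ}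

namespace IsGrid

theorem next_point (h : c.IsGrid P y) (b a : ℕ) :
    Next P (c.point y b a) (c.point y (b + 1) a) := by
  induction a with
  | zero => simpa [point] using h.next b
  | succ a ih =>
    rw [point_succ, point_succ]
    exact ih.add h.periodic

theorem grid_point (h : c.IsGrid P y) (b a : ℕ) : Grid P (c.point y b a) :=
  (h.next_point b a).1

theorem point_mem_Ico (h : c.IsGrid P y) (b a : ℕ) :
    c.point y b a ∈ Set.Ico (c.point y 0 a) (c.point y 0 a + 1) := by
  obtain ⟨h1, h2⟩ := h.mem_Ico b
  simp only [point]
  constructor <;> linarith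

theorem point_injective (h : c.IsGrid P y) (a : ℕ) : Function.Injective fun b => c.point y b a :=
  (strictMono_nat_of_lt_succ fun b => (h.next_point b a).2.2.1).injective

theorem diag (h : c.IsGrid P y) (h0 : c.Data P .diag (y 0))
    (hs : ∀ x y, Next P x y → c.Data P .diag x → c.Data P .diag (y + c.period)) (a : ℕ) :
    c.Data P .diag (c.point y a a) := by
  induction a with
  | zero => simpa [point] using h0
  | succ a ih =>
    rw [point_succ]
    exact hs _ _ (h.next_point a a) ih

end IsGrid

variable (c) in
/-- Row `a` of the grid describes the state `s.1` and the contents `s.2` of the registers below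
`n`. -/
def Describes (P : Set ℝ) (y : ℕ → ℝ) (n a : ℕ) (s : List Prog × (ℕ → ℕ)) : Prop :=
  c.Data P (.state s.1) (c.point y 0 a) ∧ ∀ r < n, c.Data P (.reg r) (c.point y (s.2 r) a)

/-- Only the presence of the correct marks is claimed. A model may carry superfluous marks, but each
rule is an implication triggered by the correct ones. -/
theorem Describes.step {I : ℕ → Set ℝ} {v : ℕ → ℝ} {n a : ℕ} {l : List Prog} {σ : ℕ → ℕ}
    (hg : c.IsGrid (I c.pred) y) (h : c.Describes (I c.pred) y n a (l, σ))
    (hl : Holds I (c.rule n l) v) (hn : registerBound l ≤ n) :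
    c.Describes (I c.pred) y n (a + 1) (step (l, σ)) := by
  obtain ⟨h1, h2⟩ := h
  have hw := hg.grid_point 0 a
  have hassign : ∀ r s, s < n → Holds I (c.assign l r s) v →
      c.Data (I c.pred) (.reg r) (c.point y (σ s) (a + 1)) := by
    intro r s hs h
    rw [point_succ]
    exact c.holds_assign.1 h _ _ hw h1 (hg.grid_point _ _) (hg.point_mem_Ico _ _) (h2 s hs)
  have hkeep : ∀ p : ℕ → Bool, Holds I (c.keep l n p) v → ∀ r < n, p r = true →
      c.Data (I c.pred) (.reg r) (c.point y (σ r) (a + 1)) :=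
    fun p h r hr hpr => hassign r r hr (c.holds_keep.1 h r hr hpr)
  have hgoto : ∀ k, Holds I (c.goto l k) v →
      c.Data (I c.pred) (.state k) (c.point y 0 (a + 1)) := by
    intro k h
    rw [point_succ]
    exact c.holds_goto.1 h _ hw h1
  have hupdate : ∀ (r j : ℕ) (p : ℕ → Bool), Holds I (c.keep l n p) v →
      (∀ s, p s = true ↔ s ≠ r) → c.Data (I c.pred) (.reg r) (c.point y j (a + 1)) →
      ∀ s < n, c.Data (I c.pred) (.reg s) (c.point y (update σ r j s) (a + 1)) := by
    intro r j p h hp hj s hs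
    by_cases hsr : s = r
    · subst hsr; simpa using hj
    · rw [Function.update_of_ne hsr]
      exact hkeep p h s hs ((hp s).2 hsr)
  rcases l with _ | ⟨r | r | ⟨r, s⟩ | ⟨p, q⟩ | ⟨r, s, p⟩, k⟩
  · exact absurd h1 (c.holds_rule_nil.1 hl _ hw)
  · simp only [rule, holds_conj, List.forall_mem_cons] at hl
    obtain ⟨h3, h4, h5, -⟩ := hl
    refine ⟨hgoto _ h3, hupdate r 0 _ h5 (by simp) ?_⟩
    rw [point_succ]
    exact c.holds_reset.1 h4 _ hw h1
  · simp only [rule, holds_conj, List.forall_mem_cons] at hl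
    obtain ⟨h3, h4, h5, -⟩ := hl
    refine ⟨hgoto _ h3, hupdate r _ _ h5 (by simp) ?_⟩
    rw [point_succ]
    exact c.holds_increment.1 h4 _ _ _ hw h1 (hg.next_point _ _) (hg.point_mem_Ico _ _)
      (h2 r (by simpa [registerBound] using hn))
  · simp only [rule, holds_conj, List.forall_mem_cons] at hl
    obtain ⟨h3, h4, h5, -⟩ := hl
    simp only [registerBound] at hn
    exact ⟨hgoto _ h3, hupdate r _ _ h5 (by simp) (hassign _ _ (by omega) h4)⟩
  · simp only [rule, holds_conj, List.forall_mem_cons] at hl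
    obtain ⟨h3, h4, -⟩ := hl
    exact ⟨hgoto _ h3, fun r hr => hkeep _ h4 r hr rfl⟩
  · simp only [rule, holds_conj, List.forall_mem_cons] at hl
    obtain ⟨h3, h4, h5, -⟩ := hl
    simp only [registerBound] at hn
    have hr := h2 r (by omega)
    have hs := h2 s (by omega)
    rw [Prog.step]
    split_ifs with hrs
    · refine ⟨?_, fun r hr => hkeep _ h5 r hr rfl⟩
      rw [point_succ]
      exact c.holds_gotoEq.1 h3 _ _ hw h1 (hg.grid_point _ _) (hg.point_mem_Ico _ _) hr
        (by dsimp only; rwa [hrs])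
    · refine ⟨?_, fun r hr => hkeep _ h5 r hr rfl⟩
      rw [point_succ]
      exact c.holds_gotoNe.1 h4 _ _ _ hw h1 (hg.grid_point _ _) (hg.grid_point _ _)
        (hg.point_mem_Ico _ _) (hg.point_mem_Ico _ _) hr hs fun h =>
          hrs (hg.point_injective a h)

theorem iterate_step_ne_nil_of_satisfiable {n : ℕ} {p : Prog} {T : List (List Prog)} {m : ℕ}
    (hp : [p] ∈ T) (hT : ∀ l ∈ T, ∀ k ∈ successors l, k ∈ T) (hn : ∀ l ∈ T, registerBound l ≤ n)
    (h : (c.history n p T m).Satisfiable) (t : ℕ) :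
    (step^[t] ([p], update (fun _ => 0) 0 m)).1 ≠ [] := by
  obtain ⟨I, v, hv, hb⟩ := c.satisfiable_history.1 h
  simp only [holds_body, holds_firstRow, holds_start, holds_periodic, holds_diagonal] at hb
  obtain ⟨⟨h0, h1, h2⟩, ⟨h3, h4, h5⟩, h6, h7, h8⟩ := hb
  obtain ⟨y, hy0, hy⟩ := exists_columns h0 h2
  rw [← hy0] at hy h1
  have hg : c.IsGrid (I c.pred) y := ⟨fun b => (hy b).1, fun b => (hy b).2, h6⟩
  have hw : v 1 = c.point y 0 m := by simp [point, hv, hy0]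
  rw [hw] at h3 h4 h5
  have hstart : c.Describes (I c.pred) y n m ([p], update (fun _ => 0) 0 m) := by
    refine ⟨h3, fun r hr => ?_⟩
    by_cases hr0 : r = 0
    · subst hr0
      -- In row `m` the diagonal marker sits in column `m`, so register 0 is given the input `m`.
      simpa using h4 _ (hg.grid_point m m) (hg.point_mem_Ico m m) (hg.diag h1 h7 m)
    · simpa [hr0] using h5 r hr hr0
  have key : ∀ t, (step^[t] ([p], update (fun _ => 0) 0 m)).1 ∈ T ∧
      c.Describes (I c.pred) y n (m + t) (step^[t] ([p], update (fun _ => 0) 0 m)) := by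
    intro t
    induction t with
    | zero => exact ⟨hp, hstart⟩
    | succ t ih =>
      rw [Function.iterate_succ_apply']
      generalize step^[t] ([p], update (fun _ => 0) 0 m) = s at ih ⊢
      obtain ⟨l, σ⟩ := s
      exact ⟨hT _ ih.1 _ (step_mem_successors l σ),
        ih.2.step hg (h8 l ih.1) (hn l ih.1)⟩
  intro hnil
  obtain ⟨h9, h10, -⟩ := key t
  rw [hnil] at h9 h10
  exact c.holds_rule_nil.1 (h8 [] h9) _ (hg.grid_point 0 _) h10

end Layout
end RealDiffLogic

/-! ### The standard model of an endless run. -/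

namespace RealDiffLogic
namespace Layout
open Formula Prog
open Function (update)

/-- The columns of the standard grid. -/
noncomputable def column (b : ℕ) : ℝ := 1 - 1 / (b + 1)

theorem column_strictMono : StrictMono column := fun a b h => by
  have : (1 : ℝ) / (b + 1) < 1 / (a + 1) := Nat.one_div_lt_one_div h
  simp only [column]
  linarith

theorem column_zero : column 0 = 0 := by simp [column]

theorem column_nonneg (b : ℕ) : 0 ≤ column b := by
  rw [← column_zero]
  exact column_strictMono.monotone b.zero_le

theorem column_lt_one (b : ℕ) : column b < 1 := by
  simp only [column]
  linarith [Nat.one_div_pos_of_nat (α := ℝ) (n := b)]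

/-- The symbols in `A` have distinct indices that fit into the period of the layout. -/
structure Fits (c : Layout) (A : Set Sym) : Prop where
  four_le : 4 ≤ c.period
  lt : ∀ s ∈ A, 4 + 2 * c.index s < c.period
  injOn : Set.InjOn c.index A

variable (c : Layout)

/-- The point of the standard grid in row `a` and column `b`. -/
noncomputable def pt (a : ℤ) (b : ℕ) : ℝ := column b + ((c.period * a : ℤ) : ℝ)

theorem pt_add_period (a : ℤ) (b : ℕ) : c.pt a b + c.period = c.pt (a + 1) b := by
  simp only [pt]
  push_cast
  ring

/-- The set of reals in which the standard grid carries the data `B` with symbols in `A`. -/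
def model (A : Set Sym) (B : ℤ → ℕ → Sym → Prop) : Set ℝ :=
  {x | ∃ b, Int.fract x = column b ∧ (⌊x⌋ % c.period = 0 ∨ ⌊x⌋ % c.period = 1 ∨
    ∃ s ∈ A, ⌊x⌋ % c.period = 3 + 2 * c.index s ∧ B (⌊x⌋ / c.period) b s)}

variable {c} {A : Set Sym} {B : ℤ → ℕ → Sym → Prop}

namespace Fits

theorem pt_add_mem_model (h : c.Fits A) {a : ℤ} {b i : ℕ} (hi : i < c.period) :
    c.pt a b + i ∈ c.model A B ↔
      i = 0 ∨ i = 1 ∨ ∃ s ∈ A, i = 3 + 2 * c.index s ∧ B a b s := by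
  have hK := h.four_le
  have h1 : c.pt a b + i = column b + ((i + c.period * a : ℤ) : ℝ) := by
    simp only [pt]
    push_cast
    ring
  have h2 : ⌊column b⌋ = 0 := Int.floor_eq_zero_iff.2 ⟨column_nonneg b, column_lt_one b⟩
  have h3 : Int.fract (c.pt a b + i) = column b := by
    rw [h1, Int.fract_add_intCast]
    exact Int.fract_eq_self.2 ⟨column_nonneg b, column_lt_one b⟩
  have h4 : ⌊c.pt a b + i⌋ = i + c.period * a := by rw [h1, Int.floor_add_intCast, h2, zero_add]
  have h5 : (i : ℤ) % c.period = i := Int.emod_eq_of_lt (by omega) (by omega)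
  have h6 : (i : ℤ) / c.period = 0 := Int.ediv_eq_zero_of_lt (by omega) (by omega)
  simp only [model, Set.mem_ofPred_eq, h3, h4, column_strictMono.injective.eq_iff, exists_eq_left',
    Int.add_mul_emod_self_left, h5, Int.add_mul_ediv_left _ _ (by omega : (c.period : ℤ) ≠ 0), h6,
    zero_add]
  norm_cast

/-- A grid point needs two consecutive admissible residues modulo the period. The residues are 0, 1
and some odd numbers from 3 to at most `period - 2`, so only the pair 0, 1 qualifies, with no
wrap-around. -/
theorem grid_iff (h : c.Fits A) {x : ℝ} : Grid (c.model A B) x ↔ ∃ a b, x = c.pt a b := by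
  have hK := h.four_le
  constructor
  · rintro ⟨⟨b, hb, h1⟩, ⟨b', -, h2⟩⟩
    rw [Int.floor_add_one] at h2
    have hk0 := Int.emod_nonneg ⌊x⌋ (by omega : (c.period : ℤ) ≠ 0)
    have hk1 := Int.emod_lt_of_pos ⌊x⌋ (by omega : 0 < (c.period : ℤ))
    have hk2 := Int.emod_add_mul_ediv ⌊x⌋ c.period
    have h3 : ⌊x⌋ % c.period = 0 := by
      rw [← Int.emod_add_emod] at h2
      rcases h1 with h1 | h1 | ⟨s, hs, h1, -⟩
      · exact h1
      · rw [h1, Int.emod_eq_of_lt (by omega) (by omega)] at h2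
        omega
      · have := h.lt s hs
        rw [h1, Int.emod_eq_of_lt (by omega) (by omega)] at h2
        omega
    refine ⟨⌊x⌋ / c.period, b, ?_⟩
    rw [pt, ← hb, ← hk2, h3, zero_add, Int.mul_ediv_cancel_left _ (by omega)]
    rw [h3, zero_add] at hk2
    rw [hk2, Int.fract_add_floor]
  · rintro ⟨a, b, rfl⟩
    have h0 := (h.pt_add_mem_model (a := a) (b := b) (i := 0) (B := B) (by omega)).2 (.inl rfl)
    have h1 := (h.pt_add_mem_model (a := a) (b := b) (i := 1) (B := B) (by omega)).2
      (.inr (.inl rfl))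
    exact ⟨by simpa using h0, by simpa using h1⟩

theorem data_pt_iff (h : c.Fits A) {s : Sym} (hs : s ∈ A) {a : ℤ} {b : ℕ} :
    c.Data (c.model A B) s (c.pt a b) ↔ B a b s := by
  have := h.lt s hs
  rw [Data, h.pt_add_mem_model (by omega)]
  constructor
  · rintro (h1 | h1 | ⟨s', hs', h1, h2⟩)
    · omega
    · omega
    · rwa [h.injOn hs hs' (by omega)]
  · exact fun h1 => .inr (.inr ⟨s, hs, rfl, h1⟩)

/-- The order is lexicographic, since all columns lie in `[0, 1)` and consecutive rows are at least
4 apart. -/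
theorem pt_lt_iff (h : c.Fits A) {a a' : ℤ} {b b' : ℕ} :
    c.pt a b < c.pt a' b' ↔ a < a' ∨ a = a' ∧ b < b' := by
  have hK := h.four_le
  have hlt : ∀ {a a' : ℤ} (b b' : ℕ), a < a' → c.pt a b < c.pt a' b' := by
    intro a a' b b' haa
    have h1 : c.period * a + 1 ≤ c.period * a' := by nlinarith
    have h2 : ((c.period * a : ℤ) : ℝ) + 1 ≤ ((c.period * a' : ℤ) : ℝ) := by exact_mod_cast h1
    have := column_lt_one b
    have := column_nonneg b'
    simp only [pt]
    linarith
  constructor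
  · intro hl
    rcases lt_trichotomy a a' with haa | rfl | haa
    · exact .inl haa
    · exact .inr ⟨rfl, by simpa [pt, column_strictMono.lt_iff_lt] using hl⟩
    · exact absurd hl (hlt b' b haa).not_gt
  · rintro (haa | ⟨rfl, hb⟩)
    · exact hlt _ _ haa
    · simpa [pt, column_strictMono.lt_iff_lt] using hb

theorem next_iff (h : c.Fits A) {x y : ℝ} :
    Next (c.model A B) x y ↔ ∃ a b, x = c.pt a b ∧ y = c.pt a (b + 1) := by
  constructor
  · rintro ⟨h1, h2, h3, h4⟩
    obtain ⟨a, b, rfl⟩ := h.grid_iff.1 h1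
    obtain ⟨a', b', rfl⟩ := h.grid_iff.1 h2
    -- The right neighbour of `x` in its row is a grid point above `x`, so it cannot lie strictly
    -- below `y`.
    have h5 := h4 (c.pt a (b + 1)) (h.pt_lt_iff.2 (by omega))
    rw [h.pt_lt_iff] at h3 h5
    have h6 := mt h5 (not_not.2 (h.grid_iff.2 ⟨_, _, rfl⟩))
    obtain ⟨rfl, rfl⟩ : a' = a ∧ b' = b + 1 := by omega
    exact ⟨_, _, rfl, rfl⟩
  · rintro ⟨a, b, rfl, rfl⟩
    refine ⟨h.grid_iff.2 ⟨_, _, rfl⟩, h.grid_iff.2 ⟨_, _, rfl⟩, h.pt_lt_iff.2 (by omega), ?_⟩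
    intro z h1 h2 hz
    obtain ⟨a', b', rfl⟩ := h.grid_iff.1 hz
    rw [h.pt_lt_iff] at h1 h2
    omega

theorem pt_mem_Ico_iff (h : c.Fits A) {a a' : ℤ} {b : ℕ} :
    c.pt a' b ∈ Set.Ico (c.pt a 0) (c.pt a 0 + 1) ↔ a' = a := by
  have hK := h.four_le
  constructor
  · rintro ⟨h1, h2⟩
    have h3 : c.pt a 0 + 1 ≤ c.pt (a + 1) 0 := by
      rw [← pt_add_period]
      have : (4 : ℝ) ≤ c.period := by exact_mod_cast hK
      linarith
    rw [← not_lt, h.pt_lt_iff] at h1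
    have h4 := h.pt_lt_iff.1 (h2.trans_le h3)
    omega
  · rintro rfl
    have := column_nonneg b
    have := column_lt_one b
    simp only [pt, column_zero, Set.mem_Ico]
    constructor <;> linarith

end Fits

/-- The data of the grid that describes the computation of `p` on the input `m` from row `m`
on. -/
def trace (p : Prog) (m : ℕ) (a : ℤ) (b : ℕ) : Sym → Prop
  | .diag => a = b
  | .reg r => ∃ t : ℕ, a = m + t ∧ b = (step^[t] ([p], update (fun _ => 0) 0 m)).2 r
  | .state l => ∃ t : ℕ, a = m + t ∧ b = 0 ∧ (step^[t] ([p], update (fun _ => 0) 0 m)).1 = l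

/-- The row determines the time, so the register contents `σ` at that time are unique. This is all
that the verification of the transition rules needs from the trace. -/
theorem trace_state {p : Prog} {m : ℕ} {a : ℤ} {b : ℕ} {l : List Prog}
    (h : trace p m a b (.state l)) : b = 0 ∧ ∃ σ,
      (∀ a' b' r, a' = a → trace p m a' b' (.reg r) → b' = σ r) ∧
      (∀ k, (step (l, σ)).1 = k → trace p m (a + 1) 0 (.state k)) ∧
      ∀ r b', b' = (step (l, σ)).2 r → trace p m (a + 1) b' (.reg r) := by
  obtain ⟨t, rfl, hb, rfl⟩ := h
  refine ⟨hb, (step^[t] ([p], update (fun _ => 0) 0 m)).2, ?_, ?_, ?_⟩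
  · rintro a' b' r rfl ⟨t', ht, rfl⟩
    obtain rfl : t' = t := by omega
    rfl
  · rintro k rfl
    exact ⟨t + 1, by push_cast; ring, rfl, by rw [Function.iterate_succ_apply']⟩
  · rintro r b' rfl
    exact ⟨t + 1, by push_cast; ring, by rw [Function.iterate_succ_apply']⟩

variable (c A) in
/-- The interpretation given by the trace of a computation. -/
def interp (p : Prog) (m : ℕ) (_ : ℕ) : Set ℝ := c.model A (trace p m)

section Rules

variable {p : Prog} {m n : ℕ} {v : ℕ → ℝ} {l k : List Prog} {r s : ℕ}

theorem Fits.holds_goto (h : c.Fits A) (hl : Sym.state l ∈ A) (hk : Sym.state k ∈ A)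
    (hs : ∀ σ, (step (l, σ)).1 = k) : Holds (c.interp A p m) (c.goto l k) v := by
  rw [Layout.holds_goto]
  intro w h1 h2
  obtain ⟨a, b, rfl⟩ := h.grid_iff.1 h1
  obtain ⟨rfl, σ, -, h4, -⟩ := trace_state ((h.data_pt_iff hl).1 h2)
  rw [pt_add_period]
  exact (h.data_pt_iff hk).2 (h4 k (hs σ))

theorem Fits.holds_reset (h : c.Fits A) (hl : Sym.state l ∈ A) (hr : Sym.reg r ∈ A)
    (hs : ∀ σ, (step (l, σ)).2 r = 0) : Holds (c.interp A p m) (c.reset l r) v := by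
  rw [Layout.holds_reset]
  intro w h1 h2
  obtain ⟨a, b, rfl⟩ := h.grid_iff.1 h1
  obtain ⟨rfl, σ, -, -, h5⟩ := trace_state ((h.data_pt_iff hl).1 h2)
  rw [pt_add_period]
  exact (h.data_pt_iff hr).2 (h5 r 0 (hs σ).symm)

theorem Fits.holds_assign (h : c.Fits A) (hl : Sym.state l ∈ A) (hr : Sym.reg r ∈ A)
    (hs : Sym.reg s ∈ A) (hrs : ∀ σ, (step (l, σ)).2 r = σ s) :
    Holds (c.interp A p m) (c.assign l r s) v := by
  rw [Layout.holds_assign]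
  intro w x h1 h2 hx hwx hd
  obtain ⟨a, b, rfl⟩ := h.grid_iff.1 h1
  obtain ⟨a', b', rfl⟩ := h.grid_iff.1 hx
  obtain ⟨rfl, σ, h3, -, h5⟩ := trace_state ((h.data_pt_iff hl).1 h2)
  obtain rfl := h.pt_mem_Ico_iff.1 hwx
  rw [pt_add_period]
  refine (h.data_pt_iff hr).2 (h5 r b' ?_)
  rw [hrs, h3 _ _ _ rfl ((h.data_pt_iff hs).1 hd)]

theorem Fits.holds_increment (h : c.Fits A) (hl : Sym.state l ∈ A) (hr : Sym.reg r ∈ A)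
    (hrs : ∀ σ, (step (l, σ)).2 r = σ r + 1) :
    Holds (c.interp A p m) (c.increment l r) v := by
  rw [Layout.holds_increment]
  intro w x y h1 h2 hxy hwx hd
  obtain ⟨a, b, rfl⟩ := h.grid_iff.1 h1
  obtain ⟨a', b', rfl, rfl⟩ := h.next_iff.1 hxy
  obtain ⟨rfl, σ, h3, -, h5⟩ := trace_state ((h.data_pt_iff hl).1 h2)
  obtain rfl := h.pt_mem_Ico_iff.1 hwx
  rw [pt_add_period]
  refine (h.data_pt_iff hr).2 (h5 r _ ?_)
  rw [hrs, h3 _ _ _ rfl ((h.data_pt_iff hr).1 hd)]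

theorem Fits.holds_keep (h : c.Fits A) (hl : Sym.state l ∈ A) (hA : ∀ r < n, Sym.reg r ∈ A)
    {q : ℕ → Bool} (hq : ∀ r, q r = true → ∀ σ, (step (l, σ)).2 r = σ r) :
    Holds (c.interp A p m) (c.keep l n q) v :=
  c.holds_keep.2 fun r hr hqr => h.holds_assign hl (hA r hr) (hA r hr) (hq r hqr)

theorem Fits.holds_gotoEq (h : c.Fits A) (hl : Sym.state l ∈ A) (hk : Sym.state k ∈ A)
    (hr : Sym.reg r ∈ A) (hs : Sym.reg s ∈ A) (hrs : ∀ σ, σ r = σ s → (step (l, σ)).1 = k) :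
    Holds (c.interp A p m) (c.gotoEq l k r s) v := by
  rw [Layout.holds_gotoEq]
  intro w x h1 h2 hx hwx hd hd'
  obtain ⟨a, b, rfl⟩ := h.grid_iff.1 h1
  obtain ⟨a', b', rfl⟩ := h.grid_iff.1 hx
  obtain ⟨rfl, σ, h3, h4, -⟩ := trace_state ((h.data_pt_iff hl).1 h2)
  obtain rfl := h.pt_mem_Ico_iff.1 hwx
  rw [pt_add_period]
  refine (h.data_pt_iff hk).2 (h4 k (hrs σ ?_))
  rw [← h3 _ _ _ rfl ((h.data_pt_iff hr).1 hd), ← h3 _ _ _ rfl ((h.data_pt_iff hs).1 hd')]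

theorem Fits.holds_gotoNe (h : c.Fits A) (hl : Sym.state l ∈ A) (hk : Sym.state k ∈ A)
    (hr : Sym.reg r ∈ A) (hs : Sym.reg s ∈ A) (hrs : ∀ σ, σ r ≠ σ s → (step (l, σ)).1 = k) :
    Holds (c.interp A p m) (c.gotoNe l k r s) v := by
  rw [Layout.holds_gotoNe]
  intro w x y h1 h2 hx hy hwx hwy hd hd' hxy
  obtain ⟨a, b, rfl⟩ := h.grid_iff.1 h1
  obtain ⟨a', b', rfl⟩ := h.grid_iff.1 hx
  obtain ⟨a'', b'', rfl⟩ := h.grid_iff.1 hy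
  obtain ⟨rfl, σ, h3, h4, -⟩ := trace_state ((h.data_pt_iff hl).1 h2)
  obtain rfl := h.pt_mem_Ico_iff.1 hwx
  obtain rfl := h.pt_mem_Ico_iff.1 hwy
  rw [pt_add_period]
  refine (h.data_pt_iff hk).2 (h4 k (hrs σ fun he => hxy ?_))
  rw [h3 _ _ _ rfl ((h.data_pt_iff hr).1 hd), h3 _ _ _ rfl ((h.data_pt_iff hs).1 hd'), he]

theorem Fits.holds_rule (h : c.Fits A) (hl : Sym.state l ∈ A)
    (hA : ∀ r < n, Sym.reg r ∈ A) (hk : ∀ k ∈ successors l, Sym.state k ∈ A)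
    (hn : registerBound l ≤ n) (hnil : ∀ t, (step^[t] ([p], update (fun _ => 0) 0 m)).1 ≠ []) :
    Holds (c.interp A p m) (c.rule n l) v := by
  rcases l with _ | ⟨r | r | ⟨r, s⟩ | ⟨q, q'⟩ | ⟨r, s, q⟩, k⟩
  · rw [holds_rule_nil]
    intro w h1 h2
    obtain ⟨a, b, rfl⟩ := h.grid_iff.1 h1
    obtain ⟨t, -, -, h3⟩ := (h.data_pt_iff hl).1 h2
    exact hnil t h3
  all_goals
    simp only [registerBound] at hn
    simp only [rule, holds_conj, List.forall_mem_cons]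
  · have hr := hA r (by omega)
    refine ⟨h.holds_goto hl (hk _ rfl) fun _ => rfl, h.holds_reset hl hr fun σ => by simp [step],
      h.holds_keep hl hA fun s hs σ => ?_, by simp⟩
    simp only [ne_eq, decide_not, Bool.not_eq_eq_eq_not, Bool.not_true, decide_eq_false_iff_not]
      at hs
    simp [step, hs]
  · have hr := hA r (by omega)
    refine ⟨h.holds_goto hl (hk _ rfl) fun _ => rfl,
      h.holds_increment hl hr fun σ => by simp [step],
      h.holds_keep hl hA fun s hs σ => ?_, by simp⟩
    simp only [ne_eq, decide_not, Bool.not_eq_eq_eq_not, Bool.not_true, decide_eq_false_iff_not]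
      at hs
    simp [step, hs]
  · have hr := hA r (by omega)
    have hs := hA s (by omega)
    refine ⟨h.holds_goto hl (hk _ rfl) fun _ => rfl,
      h.holds_assign hl hr hs fun σ => by simp [step],
      h.holds_keep hl hA fun s hs σ => ?_, by simp⟩
    simp only [ne_eq, decide_not, Bool.not_eq_eq_eq_not, Bool.not_true, decide_eq_false_iff_not]
      at hs
    simp [step, hs]
  · exact ⟨h.holds_goto hl (hk _ rfl) fun _ => rfl, h.holds_keep hl hA fun _ _ _ => rfl, by simp⟩
  · have hr := hA r (by omega)
    have hs := hA s (by omega)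
    refine ⟨h.holds_gotoEq hl (hk _ (.inl rfl)) hr hs fun σ he => by simp [step, he],
      h.holds_gotoNe hl (hk _ (.inr rfl)) hr hs fun σ he => by simp [step, he],
      h.holds_keep hl hA fun _ _ σ => ?_, by simp⟩
    rw [step]
    split_ifs <;> rfl

end Rules

theorem Fits.satisfiable_history (h : c.Fits A) {n : ℕ} {p : Prog} {T : List (List Prog)} {m : ℕ}
    (hp : [p] ∈ T) (hT : ∀ l ∈ T, ∀ k ∈ successors l, k ∈ T) (hn : ∀ l ∈ T, registerBound l ≤ n)
    (hn0 : 0 < n) (hd : Sym.diag ∈ A) (hr : ∀ r < n, Sym.reg r ∈ A)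
    (hl : ∀ l ∈ T, Sym.state l ∈ A)
    (hnil : ∀ t, (step^[t] ([p], update (fun _ => 0) 0 m)).1 ≠ []) :
    (c.history n p T m).Satisfiable := by
  refine c.satisfiable_history.2 ⟨c.interp A p m,
    fun x => if x = 0 then c.pt 0 0 else c.pt m 0, ?_, ?_⟩
  · simp [pt]
  simp only [holds_body, holds_firstRow, holds_start, holds_periodic, holds_diagonal, if_true,
    one_ne_zero, if_false]
  refine ⟨⟨h.grid_iff.2 ⟨_, _, rfl⟩, (h.data_pt_iff hd).2 rfl, ?_⟩, ⟨?_, ?_, ?_⟩, ?_, ?_, ?_⟩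
  · intro x h1 h2
    obtain ⟨a, b, rfl⟩ := h.grid_iff.1 h2
    obtain rfl := h.pt_mem_Ico_iff.1 h1
    exact ⟨c.pt 0 (b + 1), h.next_iff.2 ⟨_, _, rfl, rfl⟩, h.pt_mem_Ico_iff.2 rfl⟩
  · exact (h.data_pt_iff (hl _ hp)).2 ⟨0, by simp, rfl, rfl⟩
  · intro x h1 h2 h3
    obtain ⟨a, b, rfl⟩ := h.grid_iff.1 h1
    obtain rfl := h.pt_mem_Ico_iff.1 h2
    have h4 : (m : ℤ) = b := (h.data_pt_iff hd).1 h3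
    exact (h.data_pt_iff (hr 0 hn0)).2 ⟨0, by simp, by simp; omega⟩
  · intro r hrn hr0
    exact (h.data_pt_iff (hr r hrn)).2 ⟨0, by simp, by simp [hr0]⟩
  · intro x
    rw [interp, h.grid_iff, h.grid_iff]
    constructor
    · rintro ⟨a, b, rfl⟩
      exact ⟨a + 1, b, c.pt_add_period a b⟩
    -- Going down one row may lead below row 0, which is why the standard grid has rows indexed by
    -- ℤ.
    · rintro ⟨a, b, hx⟩
      refine ⟨a - 1, b, add_right_cancel (b := (c.period : ℝ)) ?_⟩
      rw [hx, pt_add_period, sub_add_cancel]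
  · intro x y h1 h2
    obtain ⟨a, b, rfl, rfl⟩ := h.next_iff.1 h1
    have h3 : a = b := (h.data_pt_iff hd).1 h2
    rw [pt_add_period]
    refine (h.data_pt_iff hd).2 (?_ : a + 1 = ((b + 1 : ℕ) : ℤ))
    omega
  · exact fun l hlT => h.holds_rule (hl l hlT) hr (fun k hk => hl k (hT l hlT k hk)) (hn l hlT) hnil

end Layout
end RealDiffLogic

/-! ### The reduction from the halting problem. -/

namespace RealDiffLogic
open Formula Prog

namespace Layout

/-- The layout with predicate symbol `p` for the symbols in a given list. -/
noncomputable def ofList (p : ℕ) (A : List Sym) : Layout :=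
  open Classical in ⟨p, 2 * A.length + 4, fun s => A.idxOf s⟩

theorem fits_ofList (p : ℕ) (A : List Sym) : (ofList p A).Fits {s | s ∈ A} := by
  classical
  refine ⟨by simp [ofList], fun s hs => ?_, fun s hs t _ h => ?_⟩
  · have : A.idxOf s < A.length := List.idxOf_lt_length_of_mem hs
    simp only [ofList]
    convert (by omega : 4 + 2 * A.idxOf s < 2 * A.length + 4)
  · simp only [ofList] at h
    exact (List.idxOf_inj hs).1 (by convert h)

theorem exists_history_satisfiable_iff {f : ℕ →. ℕ} (hf : Partrec f) (pr : ℕ) :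
    ∃ (c : Layout) (n : ℕ) (p : Prog) (T : List (List Prog)), c.pred = pr ∧
      ∀ m, (c.history n p T m).Satisfiable ↔ ¬ (f m).Dom := by
  obtain ⟨p, hp⟩ := exists_exec_iff_dom hf
  obtain ⟨T, hpT, hT⟩ := exists_finset_successors_subset p
  -- The added 1 ensures that the input register 0 is tracked.
  let n := T.sup registerBound + 1
  have hn : ∀ l ∈ T.toList, registerBound l ≤ n := fun l hl =>
    (Finset.le_sup (f := registerBound) (Finset.mem_toList.1 hl)).trans (Nat.le_succ _)
  have hT' : ∀ l ∈ T.toList, ∀ k ∈ successors l, k ∈ T.toList := fun l hl k hk =>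
    Finset.mem_toList.2 (hT l (Finset.mem_toList.1 hl) hk)
  rw [← Finset.mem_toList] at hpT
  let A : List Sym := .diag :: ((List.range n).map .reg ++ T.toList.map .state)
  refine ⟨ofList pr A, n, p, T.toList, rfl, fun m => ?_⟩
  rw [← hp, exists_exec_iff_iterate_step, not_exists]
  constructor
  · exact iterate_step_ne_nil_of_satisfiable hpT hT' hn
  · refine (fits_ofList pr A).satisfiable_history hpT hT' hn (by omega) ?_ ?_ ?_
    · simp [A]
    · intro r hr
      simp [A, hr]
    · intro l hl
      simpa [A] using hl

/-- The input occurs in a single integer constant of an otherwise fixed formula, so the Gödel number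
arises from `m` by finitely many pairings and affine maps. -/
theorem computable_history (c : Layout) (n : ℕ) (p : Prog) (T : List (List Prog)) :
    Computable (c.history n p T) := by
  have hpair : ∀ {g h : ℕ → ℕ}, Primrec g → Primrec h → Primrec fun m => Nat.pair (g m) (h m) :=
    fun hg hh => Primrec₂.natPair.comp hg hh
  have hlin : ∀ {g : ℕ → ℕ} (a b : ℕ), Primrec g → Primrec fun m => a * g m + b :=
    fun a b hg => Primrec.nat_add.comp (Primrec.nat_mul.comp (.const a) hg) (.const b)
  have hint : ∀ k : ℕ, Encodable.encode (k : ℤ) = 2 * k + 0 := fun k => rfl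
  refine Computable.encode_iff.1 (Primrec.to_comp ?_)
  simp only [encode_eq, history, Formula.encode, Cmp.code, hint]
  exact hlin _ _ (hpair (.const 0) (hlin _ _ (hpair (.const 1) (hlin _ _ (hpair
    (hlin _ _ (hlin _ _ (hpair (.const _) (hlin _ _ (hlin c.period 0 .id))))) (.const _))))))

end Layout

namespace Formula

theorem DecidableFragment.mono {F G : Set Formula} (h : F ⊆ G) (hG : DecidableFragment G) :
    DecidableFragment F := by
  obtain ⟨f, hf, hd⟩ := hG
  exact ⟨f, hf, fun φ hφ => hd φ (h hφ)⟩

/-- The algorithm may diverge outside `F`, but composed with a map into `F` it is total. -/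
theorem DecidableFragment.computablePred {F : Set Formula} (hF : DecidableFragment F)
    {α : Type*} [Primcodable α] {g : α → Formula} (hg : Computable g) (hgF : ∀ a, g a ∈ F) :
    ComputablePred fun a => (g a).Satisfiable := by
  obtain ⟨f, hf, hd⟩ := hF
  choose b hb hsat using fun a => hd (g a) (hgF a)
  have hbc : Computable b := (hf.comp hg).of_eq fun a => Part.eq_some_iff.2 (hb a)
  refine ComputablePred.computable_iff.2 ⟨b, hbc, ?_⟩
  funext a
  exact propext (hsat a).symm

theorem not_decidableFragment_singlePredicate (p : ℕ) :
    ¬ DecidableFragment (singlePredicate p) := by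
  intro h
  -- The program used is universal: it reads `m` as a code and runs that code on 0. Deciding
  -- satisfiability would thus decide non-halting, hence halting.
  have hf : Partrec fun m => Nat.Partrec.Code.eval (Denumerable.ofNat _ m) 0 :=
    Nat.Partrec.Code.eval_part.comp (Computable.ofNat _) (.const 0)
  obtain ⟨c, n, q, T, rfl, hc⟩ := Layout.exists_history_satisfiable_iff hf p
  have h1 := h.computablePred ((c.computable_history n q T).comp Computable.encode)
    fun e : Nat.Partrec.Code => c.preds_history n q T (Encodable.encode e)
  simp only [hc, Denumerable.ofNat_encode] at h1
  refine ComputablePred.halting_problem 0 ?_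
  simpa only [not_not] using h1.not

end Formula
end RealDiffLogic

theorem mainTheorem2 :
    (∀ p : ℕ, ¬ RealDiffLogic.Formula.DecidableFragment
      (RealDiffLogic.Formula.singlePredicate p)) ∧
    ¬ RealDiffLogic.Formula.DecidableFragment Set.univ :=
  ⟨RealDiffLogic.Formula.not_decidableFragment_singlePredicate, fun h =>
    RealDiffLogic.Formula.not_decidableFragment_singlePredicate 0 (h.mono (Set.subset_univ _))⟩
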